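/- Let $X,Y$ be (real or complex) Banach spaces and assume that $Y$ is continuously embedded into $X$. Let $T>0$, set $J=(0,T)$, and let $s\in(1,\infty)$. For $\theta\in(0,1)$ and $q\in[1,\infty)$ let $(X,Y)_{\theta,q}$ be the real interpolation space of all $x\in X$ for which \[ \|x\|_{(X,Y)_{\theta,q}} = \Bigl(\int_0^\infty \bigl(t^{-\theta}K(t,x)\bigr)^q\,\frac{dt}{t}\Bigr)^{1/q} <\infty , \qquad K(t,x)=\inf_{y\in Y}\bigl(\|x-y\|_X+t\|y\|_Y\bigr). \] Let $W^{1,s}(J;X)$ be the space of all $u\in L^s(J;X)$ with weak derivative $u'\in L^s(J;X)$, with norm equivalent to $\|u\|_{L^s(J;X)}+\|u'\|_{L^s(J;X)}$, and let $W^{1,s}(J;X)\cap L^s(J;Y)$ carry a norm equivalent to $\|u\|_{W^{1,s}(J;X)}+\|u\|_{L^s(J;Y)}$. For a normed space $Z$ let $C(\overline J;Z)$ carry the supremum norm, and for $\beta\in(0,1)$ let $C^\beta(J;Z)$ be the space of bounded $\beta$-Hölder continuous functions $f\colon J\to Z$ with norm $\sup_{t\in J}\|f(t)\|_Z+\sup_{t_1\neq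 t_2}\|f(t_1)-f(t_2)\|_Z/|t_1-t_2|^\beta$. Below, $\hookrightarrow$ denotes a continuous injective linear map that sends each $u$ to a function equal to $u$ almost everywhere on $J$. Then the following hold. (a) $W^{1,s}(J;X)\cap L^s(J;Y)\hookrightarrow C\bigl(\overline J;(X,Y)_{1-\frac1s,s}\bigr)$. (b) If $\theta\in(0,1-\frac1s)$ and $\beta=1-\frac1s-\theta$, then $W^{1,s}(J;X)\cap L^s(J;Y)\hookrightarrow C^\beta\bigl(J;(X,Y)_{\theta,1}\bigr)$. -/

import Mathlib

open Set MeasureTheory Filter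
open scoped ENNReal NNReal ContDiff BoundedContinuousFunction

instance factOneLeOfReal (s : ℝ) [hs : Fact (1 < s)] : Fact (1 ≤ ENNReal.ofReal s) :=
  ⟨ENNReal.one_le_ofReal.2 hs.out.le⟩

section RealInterpolation

variable {𝕜 X Y : Type*} [RCLike 𝕜] [NormedAddCommGroup X] [NormedSpace 𝕜 X]
  [NormedAddCommGroup Y] [NormedSpace 𝕜 Y]

/-- The K-functional `K(t, x; X, Y) = inf { ‖x₀‖_X + t ‖x₁‖_Y : x = x₀ + x₁ }` of the couple
`(X, Y)`, where `Y` is regarded as a subspace of `X` through `ι`. It is used for `t > 0` only. -/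
noncomputable def kFunctional (ι : Y →L[𝕜] X) (t : ℝ) (x : X) : ℝ :=
  ⨅ y : Y, (‖x - ι y‖ + t * ‖y‖)

/-- The measure `dt / t` on `(0, ∞)`. -/
noncomputable def dtOverT : Measure ℝ :=
  (volume.restrict (Ioi (0 : ℝ))).withDensity fun t => ENNReal.ofReal t⁻¹

/-- The norm of the real interpolation space `(X, Y)_{θ, q}` given by the K-method, with value
`∞` outside of the space: the norm of `t ↦ t ^ (-θ) * K(t, x)` in `L^q((0, ∞), dt / t)`. -/
noncomputable def realInterpENorm (ι : Y →L[𝕜] X) (θ : ℝ) (q : ℝ≥0∞) (x : X) : ℝ≥0∞ :=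
  eLpNorm (fun t => t ^ (-θ) * kFunctional ι t x) q dtOverT

theorem kFunctional_bddBelow (ι : Y →L[𝕜] X) {t : ℝ} (ht : 0 ≤ t) (x : X) :
    BddBelow (range fun y : Y => ‖x - ι y‖ + t * ‖y‖) :=
  ⟨0, by rintro _ ⟨y, rfl⟩; positivity⟩

theorem kFunctional_nonneg (ι : Y →L[𝕜] X) {t : ℝ} (ht : 0 ≤ t) (x : X) :
    0 ≤ kFunctional ι t x :=
  Real.iInf_nonneg fun y => by positivity

theorem kFunctional_le (ι : Y →L[𝕜] X) {t : ℝ} (ht : 0 ≤ t) (x : X) (y : Y) :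
    kFunctional ι t x ≤ ‖x - ι y‖ + t * ‖y‖ :=
  ciInf_le (kFunctional_bddBelow ι ht x) y

theorem kFunctional_add_le (ι : Y →L[𝕜] X) {t : ℝ} (ht : 0 ≤ t) (x x' : X) :
    kFunctional ι t (x + x') ≤ kFunctional ι t x + kFunctional ι t x' := by
  refine le_ciInf_add_ciInf fun y y' => (kFunctional_le ι ht _ (y + y')).trans ?_
  have h1 : ‖x + x' - ι (y + y')‖ ≤ ‖x - ι y‖ + ‖x' - ι y'‖ := by
    rw [map_add, add_sub_add_comm]; exact norm_add_le _ _
  have h2 : t * ‖y + y'‖ ≤ t * (‖y‖ + ‖y'‖) := by gcongr; exact norm_add_le _ _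
  linarith

theorem kFunctional_smul_le (ι : Y →L[𝕜] X) {t : ℝ} (ht : 0 ≤ t) (c : 𝕜) (x : X) :
    kFunctional ι t (c • x) ≤ ‖c‖ * kFunctional ι t x := by
  rw [kFunctional, kFunctional, Real.mul_iInf_of_nonneg (norm_nonneg c)]
  refine le_ciInf fun y => (kFunctional_le ι ht _ (c • y)).trans (le_of_eq ?_)
  rw [map_smul, ← smul_sub, norm_smul, norm_smul]
  ring

theorem kFunctional_smul (ι : Y →L[𝕜] X) {t : ℝ} (ht : 0 ≤ t) (c : 𝕜) (x : X) :
    kFunctional ι t (c • x) = ‖c‖ * kFunctional ι t x := by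
  refine le_antisymm (kFunctional_smul_le ι ht c x) ?_
  rcases eq_or_ne c 0 with rfl | hc
  · simpa using kFunctional_nonneg ι ht (0 : X)
  · have h := kFunctional_smul_le ι ht c⁻¹ (c • x)
    rw [inv_smul_smul₀ hc, norm_inv] at h
    have hc' : 0 < ‖c‖ := norm_pos_iff.2 hc
    rwa [le_inv_mul_iff₀ hc'] at h

theorem eq_zero_of_kFunctional_eq_zero (ι : Y →L[𝕜] X) {t : ℝ} (ht : 0 < t) {x : X}
    (hx : kFunctional ι t x = 0) : x = 0 := by
  have hM : 0 < 1 + ‖ι‖ / t := by positivity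
  have h : ‖x‖ / (1 + ‖ι‖ / t) ≤ kFunctional ι t x := by
    refine le_ciInf fun y => ?_
    rw [div_le_iff₀ hM]
    have h1 : ‖x‖ ≤ ‖x - ι y‖ + ‖ι y‖ := by simpa using norm_add_le (x - ι y) (ι y)
    have h2 := ι.le_opNorm y
    have h3 : (‖x - ι y‖ + t * ‖y‖) * (1 + ‖ι‖ / t) =
        ‖x - ι y‖ + ‖ι‖ * ‖y‖ + (t * ‖y‖ + ‖x - ι y‖ * (‖ι‖ / t)) := by
      field_simp; ring
    have h4 : 0 ≤ t * ‖y‖ + ‖x - ι y‖ * (‖ι‖ / t) := by positivity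
    linarith
  rw [hx, div_le_iff₀ hM, zero_mul] at h
  exact norm_le_zero_iff.1 h

theorem dtOverT_absolutelyContinuous : dtOverT ≪ volume.restrict (Ioi (0 : ℝ)) :=
  withDensity_absolutelyContinuous _ _

theorem ae_dtOverT_pos : ∀ᵐ t ∂dtOverT, 0 < t :=
  dtOverT_absolutelyContinuous.ae_le (ae_restrict_mem measurableSet_Ioi)

theorem dtOverT_ne_zero : dtOverT ≠ 0 := by
  intro h
  rw [dtOverT, withDensity_eq_zero_iff (by fun_prop)] at h
  have h2 : ∀ᵐ _ ∂volume.restrict (Ioi (0 : ℝ)), False := by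
    filter_upwards [h, ae_restrict_mem measurableSet_Ioi] with t h1 ht
    simp only [Pi.zero_apply, ENNReal.ofReal_eq_zero, inv_nonpos] at h1
    exact absurd (mem_Ioi.1 ht) (not_lt.2 h1)
  have h3 : volume.restrict (Ioi (0 : ℝ)) = 0 := ae_eq_bot.1 (eventually_false_iff_eq_bot.1 h2)
  rw [Measure.restrict_eq_zero, Real.volume_Ioi] at h3
  exact ENNReal.top_ne_zero h3

theorem aestronglyMeasurable_kFunctional (ι : Y →L[𝕜] X) (θ : ℝ) (x : X) :
    AEStronglyMeasurable (fun t => t ^ (-θ) * kFunctional ι t x) dtOverT := by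
  refine AEStronglyMeasurable.mono_ac dtOverT_absolutelyContinuous ?_
  have h : MonotoneOn (fun t => kFunctional ι t x) (Ioi 0) := fun t ht t' _ htt' =>
    ciInf_mono (kFunctional_bddBelow ι (le_of_lt ht) x) fun y => by gcongr
  exact ((measurable_id.pow_const (-θ)).aemeasurable.mul
    (aemeasurable_restrict_of_monotoneOn measurableSet_Ioi h)).aestronglyMeasurable

theorem realInterpENorm_add_le (ι : Y →L[𝕜] X) (θ : ℝ) (q : ℝ≥0∞) [hq : Fact (1 ≤ q)]
    (x x' : X) :
    realInterpENorm ι θ q (x + x') ≤ realInterpENorm ι θ q x + realInterpENorm ι θ q x' := by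
  refine le_trans ?_ (eLpNorm_add_le (aestronglyMeasurable_kFunctional ι θ x)
    (aestronglyMeasurable_kFunctional ι θ x') hq.out)
  refine eLpNorm_mono_ae ?_
  filter_upwards [ae_dtOverT_pos] with t ht
  have h0 : 0 ≤ t ^ (-θ) := Real.rpow_nonneg ht.le _
  have h1 := kFunctional_nonneg ι ht.le (x + x')
  have h2 := kFunctional_add_le ι ht.le x x'
  rw [Pi.add_apply, ← mul_add, norm_mul, norm_mul]
  gcongr
  rw [Real.norm_of_nonneg h1]
  exact h2.trans (le_abs_self _)

theorem realInterpENorm_smul (ι : Y →L[𝕜] X) (θ : ℝ) (q : ℝ≥0∞) (c : 𝕜) (x : X) :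
    realInterpENorm ι θ q (c • x) = ‖c‖ₑ * realInterpENorm ι θ q x := by
  have h : (fun t => t ^ (-θ) * kFunctional ι t (c • x)) =ᵐ[dtOverT]
      ‖c‖ • fun t => t ^ (-θ) * kFunctional ι t x := by
    filter_upwards [ae_dtOverT_pos] with t ht
    rw [kFunctional_smul ι ht.le, Pi.smul_apply, smul_eq_mul]
    ring
  rw [realInterpENorm, eLpNorm_congr_ae h, eLpNorm_const_smul, enorm_norm, realInterpENorm]

theorem eq_zero_of_realInterpENorm_eq_zero (ι : Y →L[𝕜] X) (θ : ℝ) (q : ℝ≥0∞)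
    [hq : Fact (1 ≤ q)] {x : X} (hx : realInterpENorm ι θ q x = 0) : x = 0 := by
  have hq0 : q ≠ 0 := (zero_lt_one.trans_le hq.out).ne'
  have h := (eLpNorm_eq_zero_iff (aestronglyMeasurable_kFunctional ι θ x) hq0).1 hx
  have : NeZero dtOverT := ⟨dtOverT_ne_zero⟩
  obtain ⟨t, ht0, ht⟩ := (h.and ae_dtOverT_pos).exists
  have h0 : t ^ (-θ) ≠ 0 := (Real.rpow_pos_of_pos ht _).ne'
  exact eq_zero_of_kFunctional_eq_zero ι ht ((mul_eq_zero.1 ht0).resolve_left h0)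

/-- The elements of the real interpolation space `(X, Y)_{θ, q}`, as a subspace of `X`. -/
def realInterpSubmodule (ι : Y →L[𝕜] X) (θ : ℝ) (q : ℝ≥0∞) [Fact (1 ≤ q)] :
    Submodule 𝕜 X where
  carrier := {x | realInterpENorm ι θ q x < ⊤}
  zero_mem' := by
    have h := realInterpENorm_smul ι θ q (0 : 𝕜) 0
    simp only [zero_smul, enorm_zero, zero_mul] at h
    simp [h]
  add_mem' ha hb := (realInterpENorm_add_le ι θ q _ _).trans_lt (ENNReal.add_lt_top.2 ⟨ha, hb⟩)
  smul_mem' c x hx := by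
    rw [mem_ofPred_eq, realInterpENorm_smul]
    exact ENNReal.mul_lt_top enorm_lt_top hx

/-- The real interpolation space `(X, Y)_{θ, q}`, with its own norm (not the norm of `X`). -/
def RealInterp (ι : Y →L[𝕜] X) (θ : ℝ) (q : ℝ≥0∞) [Fact (1 ≤ q)] : Type _ :=
  realInterpSubmodule ι θ q

namespace RealInterp

variable (ι : Y →L[𝕜] X) (θ : ℝ) (q : ℝ≥0∞) [Fact (1 ≤ q)]

instance : AddCommGroup (RealInterp ι θ q) :=
  inferInstanceAs (AddCommGroup (realInterpSubmodule ι θ q))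

instance : Module 𝕜 (RealInterp ι θ q) :=
  inferInstanceAs (Module 𝕜 (realInterpSubmodule ι θ q))

/-- The inclusion of `(X, Y)_{θ, q}` into `X`. -/
def incl : RealInterp ι θ q →ₗ[𝕜] X := (realInterpSubmodule ι θ q).subtype

noncomputable instance : Norm (RealInterp ι θ q) :=
  ⟨fun x => (realInterpENorm ι θ q (incl ι θ q x)).toReal⟩

theorem norm_def (x : RealInterp ι θ q) :
    ‖x‖ = (realInterpENorm ι θ q (incl ι θ q x)).toReal := rfl

theorem incl_injective : Function.Injective (incl ι θ q) := Subtype.val_injective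

theorem enorm_incl_lt_top (x : RealInterp ι θ q) :
    realInterpENorm ι θ q (incl ι θ q x) < ⊤ := x.2

theorem normCore : NormedSpace.Core 𝕜 (RealInterp ι θ q) where
  norm_nonneg _ := ENNReal.toReal_nonneg
  norm_smul c x := by
    rw [norm_def, norm_def, map_smul, realInterpENorm_smul, ENNReal.toReal_mul, toReal_enorm]
  norm_triangle x y := by
    have hx := (enorm_incl_lt_top ι θ q x).ne
    have hy := (enorm_incl_lt_top ι θ q y).ne
    rw [norm_def, norm_def, norm_def, map_add, ← ENNReal.toReal_add hx hy]
    exact ENNReal.toReal_mono (ENNReal.add_ne_top.2 ⟨hx, hy⟩) (realInterpENorm_add_le ι θ q _ _)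
  norm_eq_zero_iff x := by
    constructor
    · intro h
      rw [norm_def, ENNReal.toReal_eq_zero_iff] at h
      have h0 := h.resolve_right (enorm_incl_lt_top ι θ q x).ne
      exact incl_injective ι θ q
        ((eq_zero_of_realInterpENorm_eq_zero ι θ q h0).trans (map_zero _).symm)
    · rintro rfl
      have h := realInterpENorm_smul ι θ q (0 : 𝕜) 0
      simp only [zero_smul, enorm_zero, zero_mul] at h
      rw [norm_def, map_zero, h, ENNReal.toReal_zero]

noncomputable instance : NormedAddCommGroup (RealInterp ι θ q) :=
  NormedAddCommGroup.ofCore (normCore ι θ q)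

noncomputable instance : NormedSpace 𝕜 (RealInterp ι θ q) :=
  NormedSpace.ofCore (normCore ι θ q)

end RealInterp

end RealInterpolation

section Hoelder

variable (𝕜 : Type*) [RCLike 𝕜] (A : Type*) [MetricSpace A] (β : ℝ≥0)
  (Z : Type*) [NormedAddCommGroup Z] [NormedSpace 𝕜 Z]

/-- The bounded continuous functions `A → Z` that are Hölder continuous of exponent `β`. -/
def hoelderSubmodule : Submodule 𝕜 (A →ᵇ Z) where
  carrier := {f | MemHolder β (f : A → Z)}
  zero_mem' := memHolder_zero
  add_mem' hf hg := hf.add hg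
  smul_mem' _ _ hf := hf.smul

/-- The space `C^β(A; Z)` of bounded Hölder continuous functions of exponent `β`, normed by the
sum of the supremum norm and the Hölder seminorm. -/
def HoelderSpace : Type _ := hoelderSubmodule 𝕜 A β Z

namespace HoelderSpace

noncomputable instance : AddCommGroup (HoelderSpace 𝕜 A β Z) :=
  inferInstanceAs (AddCommGroup (hoelderSubmodule 𝕜 A β Z))

noncomputable instance : Module 𝕜 (HoelderSpace 𝕜 A β Z) :=
  inferInstanceAs (Module 𝕜 (hoelderSubmodule 𝕜 A β Z))

/-- The inclusion of `C^β(A; Z)` into the bounded continuous functions. -/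
noncomputable def toBCF : HoelderSpace 𝕜 A β Z →ₗ[𝕜] (A →ᵇ Z) := (hoelderSubmodule 𝕜 A β Z).subtype

noncomputable instance : Norm (HoelderSpace 𝕜 A β Z) :=
  ⟨fun f => ‖toBCF 𝕜 A β Z f‖ + nnHolderNorm β (toBCF 𝕜 A β Z f : A → Z)⟩

theorem norm_def (f : HoelderSpace 𝕜 A β Z) :
    ‖f‖ = ‖toBCF 𝕜 A β Z f‖ + nnHolderNorm β (toBCF 𝕜 A β Z f : A → Z) := rfl

theorem toBCF_injective : Function.Injective (toBCF 𝕜 A β Z) := Subtype.val_injective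

theorem memHolder (f : HoelderSpace 𝕜 A β Z) : MemHolder β (toBCF 𝕜 A β Z f : A → Z) := f.2

theorem normCore : NormedSpace.Core 𝕜 (HoelderSpace 𝕜 A β Z) where
  norm_nonneg f := by rw [norm_def]; positivity
  norm_smul c f := by
    rw [norm_def, norm_def, map_smul, norm_smul, BoundedContinuousFunction.coe_smul]
    have h := (memHolder 𝕜 A β Z f).nnHolderNorm_smul c
    have h' : nnHolderNorm β (fun x => c • toBCF 𝕜 A β Z f x) =
        ‖c‖₊ * nnHolderNorm β (toBCF 𝕜 A β Z f : A → Z) := h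
    rw [h', NNReal.coe_mul, coe_nnnorm, mul_add]
  norm_triangle f g := by
    rw [norm_def, norm_def, norm_def, map_add, BoundedContinuousFunction.coe_add]
    have h : (nnHolderNorm β ((toBCF 𝕜 A β Z f : A → Z) + (toBCF 𝕜 A β Z g : A → Z)) : ℝ) ≤
        nnHolderNorm β (toBCF 𝕜 A β Z f : A → Z) + nnHolderNorm β (toBCF 𝕜 A β Z g : A → Z) := by
      exact_mod_cast (memHolder 𝕜 A β Z f).nnHolderNorm_add_le (memHolder 𝕜 A β Z g)
    have h' := norm_add_le (toBCF 𝕜 A β Z f) (toBCF 𝕜 A β Z g)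
    linarith
  norm_eq_zero_iff f := by
    constructor
    · intro h
      rw [norm_def] at h
      have h1 : ‖toBCF 𝕜 A β Z f‖ = 0 :=
        le_antisymm (by linarith [(nnHolderNorm β (toBCF 𝕜 A β Z f : A → Z)).coe_nonneg])
          (norm_nonneg _)
      exact toBCF_injective 𝕜 A β Z ((norm_eq_zero.1 h1).trans (map_zero _).symm)
    · rintro rfl
      rw [norm_def, map_zero, norm_zero, BoundedContinuousFunction.coe_zero, nnHolderNorm_zero]
      simp

noncomputable instance : NormedAddCommGroup (HoelderSpace 𝕜 A β Z) :=
  NormedAddCommGroup.ofCore (normCore 𝕜 A β Z)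

noncomputable instance : NormedSpace 𝕜 (HoelderSpace 𝕜 A β Z) :=
  NormedSpace.ofCore (normCore 𝕜 A β Z)

end HoelderSpace

end Hoelder

section Sobolev

/-- Lebesgue measure on the interval `J = (0, T)`. -/
noncomputable abbrev volJ (T : ℝ) : Measure ℝ := volume.restrict (Ioo 0 T)

/-- `v` is the weak derivative of `u` on `(0, T)`. -/
def IsWeakDeriv {X : Type*} [NormedAddCommGroup X] [NormedSpace ℝ X] (T : ℝ) (u v : ℝ → X) :
    Prop :=
  ∀ φ : ℝ → ℝ, ContDiff ℝ ∞ φ → HasCompactSupport φ → tsupport φ ⊆ Ioo 0 T →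
    ∫ t, deriv φ t • u t ∂volJ T = -∫ t, φ t • v t ∂volJ T

theorem integrable_testFunction_smul {X : Type*} [NormedAddCommGroup X] [NormedSpace ℝ X]
    {T : ℝ} {p : ℝ≥0∞} [hp : Fact (1 ≤ p)] {φ : ℝ → ℝ} (hφ : Continuous φ)
    (hc : HasCompactSupport φ) (u : Lp X p (volJ T)) :
    Integrable (fun t => φ t • u t) (volJ T) := by
  obtain ⟨C, hC⟩ := hc.exists_bound_of_continuous hφ
  exact ((Lp.memLp u).integrable hp.out).bdd_smul C hφ.aestronglyMeasurable (.of_forall hC)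

variable (𝕜 : Type*) {X Y : Type*} [RCLike 𝕜] [NormedAddCommGroup X] [NormedSpace 𝕜 X]
  [NormedAddCommGroup Y] [NormedSpace 𝕜 Y]

/-- The Sobolev space `W^{1,p}(J; X)`, `J = (0, T)`: the functions `u ∈ L^p(J; X)` with a weak
derivative `u' ∈ L^p(J; X)`. An element is the pair `(u, u')`, and `u` determines `u'`;
the norm is `max ‖u‖_{L^p(J; X)} ‖u'‖_{L^p(J; X)}`. -/
def SobolevW1 (X : Type*) [NormedAddCommGroup X] [NormedSpace 𝕜 X] [NormedSpace ℝ X]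
    [IsScalarTower ℝ 𝕜 X] (p : ℝ≥0∞) [Fact (1 ≤ p)] (T : ℝ) :
    Submodule 𝕜 (Lp X p (volJ T) × Lp X p (volJ T)) where
  carrier := {w | IsWeakDeriv T w.1 w.2}
  zero_mem' := by
    intro φ _ _ _
    have h : ∀ ψ : ℝ → ℝ, ∫ t, ψ t • (0 : Lp X p (volJ T)) t ∂volJ T = 0 := by
      intro ψ
      refine integral_eq_zero_of_ae ?_
      filter_upwards [Lp.coeFn_zero X p (volJ T)] with t ht
      rw [ht, Pi.zero_apply, smul_zero]
    simp only [Prod.fst_zero, Prod.snd_zero, h, neg_zero]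
  add_mem' := by
    rintro ⟨u, u'⟩ ⟨v, v'⟩ hu hv φ h1 h2 h3
    have h : ∀ ψ : ℝ → ℝ, Continuous ψ → HasCompactSupport ψ → ∀ f g : Lp X p (volJ T),
        ∫ t, ψ t • (f + g) t ∂volJ T = ∫ t, ψ t • f t ∂volJ T + ∫ t, ψ t • g t ∂volJ T := by
      intro ψ hψ hc f g
      rw [← integral_add (integrable_testFunction_smul hψ hc f)
        (integrable_testFunction_smul hψ hc g)]
      refine integral_congr_ae ?_
      filter_upwards [Lp.coeFn_add f g] with t ht
      rw [ht, Pi.add_apply, smul_add]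
    have hu' := hu φ h1 h2 h3
    have hv' := hv φ h1 h2 h3
    simp only [Prod.mk_add_mk] at hu' hv' ⊢
    rw [h _ (h1.continuous_deriv (by simp)) h2.deriv, h _ h1.continuous h2, hu', hv', neg_add]
  smul_mem' := by
    rintro c ⟨u, u'⟩ hu φ h1 h2 h3
    have h : ∀ (ψ : ℝ → ℝ) (f : Lp X p (volJ T)),
        ∫ t, ψ t • (c • f : Lp X p (volJ T)) t ∂volJ T = c • ∫ t, ψ t • f t ∂volJ T := by
      intro ψ f
      have : SMulCommClass ℝ 𝕜 X := IsScalarTower.to_smulCommClass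
      rw [← integral_smul]
      refine integral_congr_ae ?_
      filter_upwards [Lp.coeFn_smul c f] with t ht
      rw [ht, Pi.smul_apply, smul_comm]
    have hu' := hu φ h1 h2 h3
    simp only [Prod.smul_mk] at hu' ⊢
    rw [h, h, hu', smul_neg]

variable {𝕜} [NormedSpace ℝ X] [IsScalarTower ℝ 𝕜 X]

/-- The space `W^{1,p}(J; X) ∩ L^p(J; Y)`, `J = (0, T)`, where `Y` is regarded as a subspace of `X`
through `ι`: the pairs of some `u ∈ W^{1,p}(J; X)` and some `w ∈ L^p(J; Y)` that are the same
function, normed by `max ‖u‖_{W^{1,p}(J; X)} ‖w‖_{L^p(J; Y)}`. -/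
def MaxRegSpace (ι : Y →L[𝕜] X) (p : ℝ≥0∞) [Fact (1 ≤ p)] (T : ℝ) :
    Submodule 𝕜 (SobolevW1 𝕜 X p T × Lp Y p (volJ T)) where
  carrier := {w | ι.compLpₗ p (volJ T) w.2 = w.1.1.1}
  zero_mem' := map_zero _
  add_mem' {v w} hv hw := by
    simp only [mem_ofPred_eq] at hv hw
    simp [hv, hw, -ContinuousLinearMap.compLpₗ_apply]
  smul_mem' c w hw := by
    simp only [mem_ofPred_eq] at hw
    simp [hw, -ContinuousLinearMap.compLpₗ_apply]

/-- An element of `W^{1,p}(J; X) ∩ L^p(J; Y)` as a (class of) function(s) with values in `X`. -/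
def MaxRegSpace.toLp {ι : Y →L[𝕜] X} {p : ℝ≥0∞} [Fact (1 ≤ p)] {T : ℝ}
    (u : MaxRegSpace ι p T) : Lp X p (volJ T) := u.1.1.1.1

end Sobolev

/-!
An element `u` of `W^{1,s}(J; X)` has a continuous representative, the primitive of `u'`. Let `W` be
the intersection of `[t - h, t + h]` with `J`; its length is between `h` and `2h` if `h ≤ T`. The
mean value of `u` over `W`, computed in (the completion of) `Y`, is a competitor in the definition
of the K-functional of `u(t)` and gives `K(h, u(t)) ≤ ∫_W (‖u'‖_X + ‖u‖_Y)`.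

With Hardy's inequality this bounds the part `h ≤ ε` of the norm of `u(t)` in the trace space by the
`L^s`-norm of `‖u'‖_X + ‖u‖_Y` over the window with `h = ε`, which is small uniformly in `t` for
small `ε`; the part `h > ε` is bounded by `‖u(t)‖_X`. This proves (a). With Hölder's inequality it
gives `K(h, u(t)) ≤ C h^{1 - 1/s}`, and splitting the integral that defines the norm of
`u(t) - u(t')` in `(X, Y)_{θ,1}` at `h = |t - t'|` proves (b).
-/

section TestFunctions

theorem exists_Icc_subset_of_isCompact {K U : Set ℝ} (hK : IsCompact K) (hU : U.OrdConnected)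
    (hKU : K ⊆ U) : ∃ a b, K ⊆ Icc a b ∧ Icc a b ⊆ U := by
  rcases K.eq_empty_or_nonempty with rfl | hne
  · exact ⟨1, 0, by simp⟩
  · exact ⟨sInf K, sSup K,
      fun x hx => ⟨csInf_le hK.bddBelow hx, le_csSup hK.bddAbove hx⟩,
      hU.out (hKU (hK.sInf_mem hne)) (hKU (hK.sSup_mem hne))⟩

theorem integral_Iic_eq_zero_of_notMem_Icc {φ : ℝ → ℝ} {a b : ℝ} (hφ : tsupport φ ⊆ Icc a b)
    (h0 : ∫ t, φ t = 0) {t : ℝ} (ht : t ∉ Icc a b) : ∫ r in Iic t, φ r = 0 := by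
  have hz {r : ℝ} (hr : r ∉ Icc a b) : φ r = 0 :=
    image_eq_zero_of_notMem_tsupport fun h => hr (hφ h)
  rcases lt_or_ge t a with hta | hat
  · exact setIntegral_eq_zero_of_forall_eq_zero fun r hr =>
      hz fun h => (h.1.trans hr).not_gt hta
  · have hbt : b < t := not_le.1 fun htb => ht ⟨hat, htb⟩
    exact (setIntegral_eq_integral_of_forall_compl_eq_zero fun r hr =>
      hz fun h => hr (h.2.trans hbt.le)).trans h0

/-- The space `C_c^∞(U)` of test functions on `U ⊆ ℝ`. -/
structure IsTestFunction (U : Set ℝ) (φ : ℝ → ℝ) : Prop where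
  contDiff : ContDiff ℝ ∞ φ
  hasCompactSupport : HasCompactSupport φ
  tsupport_subset : tsupport φ ⊆ U

namespace IsTestFunction

variable {U : Set ℝ} {φ ψ : ℝ → ℝ}

theorem eq_zero_of_notMem (hφ : IsTestFunction U φ) {t : ℝ} (ht : t ∉ U) : φ t = 0 :=
  image_eq_zero_of_notMem_tsupport fun h => ht (hφ.tsupport_subset h)

theorem setIntegral_eq_integral (hφ : IsTestFunction U φ) : ∫ t in U, φ t = ∫ t, φ t :=
  setIntegral_eq_integral_of_forall_compl_eq_zero fun _ => hφ.eq_zero_of_notMem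

theorem integrable (hφ : IsTestFunction U φ) : Integrable φ :=
  hφ.contDiff.continuous.integrable_of_hasCompactSupport hφ.hasCompactSupport

protected theorem deriv (hφ : IsTestFunction U φ) : IsTestFunction U (deriv φ) where
  contDiff := (contDiff_infty_iff_deriv.1 hφ.contDiff).2
  hasCompactSupport := hφ.hasCompactSupport.deriv
  tsupport_subset := tsupport_deriv_subset.trans hφ.tsupport_subset

protected theorem sub (hφ : IsTestFunction U φ) (hψ : IsTestFunction U ψ) :
    IsTestFunction U (φ - ψ) where
  contDiff := hφ.contDiff.sub hψ.contDiff
  hasCompactSupport := hφ.hasCompactSupport.sub hψ.hasCompactSupport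
  tsupport_subset :=
    (tsupport_sub φ ψ).trans (union_subset hφ.tsupport_subset hψ.tsupport_subset)

theorem const_smul (hφ : IsTestFunction U φ) (c : ℝ) : IsTestFunction U (c • φ) where
  contDiff := hφ.contDiff.const_smul c
  hasCompactSupport := hφ.hasCompactSupport.smul_left (f := fun _ => c)
  tsupport_subset := (tsupport_smul_subset_right (fun _ => c) φ).trans hφ.tsupport_subset

theorem integrable_smul {E : Type*} [NormedAddCommGroup E] [NormedSpace ℝ E] {μ : Measure ℝ}
    (hφ : IsTestFunction U φ) {u : ℝ → E} (hu : Integrable u μ) :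
    Integrable (fun t => φ t • u t) μ := by
  obtain ⟨C, hC⟩ := hφ.hasCompactSupport.exists_bound_of_continuous hφ.contDiff.continuous
  exact hu.bdd_smul C hφ.contDiff.continuous.aestronglyMeasurable (.of_forall hC)

theorem exists_deriv_eq (hφ : IsTestFunction U φ) (hU : U.OrdConnected) (h0 : ∫ t, φ t = 0) :
    ∃ Φ, IsTestFunction U Φ ∧ deriv Φ = φ := by
  obtain ⟨a, b, hab, habU⟩ :=
    exists_Icc_subset_of_isCompact hφ.hasCompactSupport hU hφ.tsupport_subset
  have hderiv (t : ℝ) : HasDerivAt (fun t => ∫ r in Iic t, φ r) (φ t) t := by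
    have h := (hφ.contDiff.continuous.integral_hasStrictDerivAt 0 t).hasDerivAt
    refine (h.const_add (∫ r in Iic (0 : ℝ), φ r)).congr_of_eventuallyEq (.of_forall fun t => ?_)
    exact eq_add_of_sub_eq' (intervalIntegral.integral_Iic_sub_Iic hφ.integrable.integrableOn
      hφ.integrable.integrableOn)
  have hd : deriv (fun t => ∫ r in Iic t, φ r) = φ := funext fun t => (hderiv t).deriv
  have hsupp : tsupport (fun t => ∫ r in Iic t, φ r) ⊆ Icc a b :=
    closure_minimal (fun t ht => by_contra fun h =>
      ht (integral_Iic_eq_zero_of_notMem_Icc hab h0 h)) isClosed_Icc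
  refine ⟨_, ⟨?_, ?_, hsupp.trans habU⟩, hd⟩
  · rw [contDiff_infty_iff_deriv, hd]
    exact ⟨fun t => (hderiv t).differentiableAt, hφ.contDiff⟩
  · exact .of_support_subset_isCompact isCompact_Icc ((subset_tsupport _).trans hsupp)

end IsTestFunction

theorem exists_isTestFunction_integral_eq_one {U : Set ℝ} (hU : IsOpen U) (hne : U.Nonempty) :
    ∃ ψ, IsTestFunction U ψ ∧ ∫ t, ψ t = 1 := by
  obtain ⟨x, hx⟩ := hne
  obtain ⟨ε, hε, hεU⟩ := Metric.nhds_basis_closedBall.mem_iff.1 (hU.mem_nhds hx)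
  let f : ContDiffBump x := ⟨ε / 2, ε, half_pos hε, half_lt_self hε⟩
  exact ⟨f.normed volume, ⟨f.contDiff_normed, f.hasCompactSupport_normed,
    f.tsupport_normed_eq.trans_subset hεU⟩, f.integral_normed⟩

section FundamentalLemmas

variable {E : Type*} [NormedAddCommGroup E] [NormedSpace ℝ E] [CompleteSpace E] {U : Set ℝ}
  {u : ℝ → E}

theorem ae_eq_zero_of_integral_testFunction_smul_eq_zero (hU : IsOpen U)
    (hu : LocallyIntegrableOn u U) (h : ∀ φ, IsTestFunction U φ → ∫ t in U, φ t • u t = 0) :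
    u =ᵐ[volume.restrict U] 0 := by
  refine (ae_restrict_iff' hU.measurableSet).2
    (hU.ae_eq_zero_of_integral_contDiff_smul_eq_zero hu fun φ h1 h2 h3 => ?_)
  have hφ : IsTestFunction U φ := ⟨h1, h2, h3⟩
  rw [← h φ hφ, setIntegral_eq_integral_of_forall_compl_eq_zero fun t ht => by
    rw [hφ.eq_zero_of_notMem ht, zero_smul]]

/-- The **du Bois-Reymond lemma**. -/
theorem exists_ae_eq_const_of_integral_deriv_smul_eq_zero (hU : IsOpen U) (hconn : U.OrdConnected)
    (hu : IntegrableOn u U) (h : ∀ φ, IsTestFunction U φ → ∫ t in U, deriv φ t • u t = 0) :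
    ∃ c : E, u =ᵐ[volume.restrict U] fun _ => c := by
  rcases U.eq_empty_or_nonempty with rfl | hne
  · exact ⟨0, by simp [EventuallyEq]⟩
  obtain ⟨ψ, hψ, hψ1⟩ := exists_isTestFunction_integral_eq_one hU hne
  set c := ∫ t in U, ψ t • u t
  have hloc : LocallyIntegrableOn (u - fun _ => c) U :=
    hu.locallyIntegrableOn.sub ((locallyIntegrable_const c).locallyIntegrableOn U)
  refine ⟨c, (sub_ae_eq_zero _ _).1 <|
    ae_eq_zero_of_integral_testFunction_smul_eq_zero hU hloc fun η hη => ?_⟩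
  -- `η - (∫ η) ψ` has vanishing integral, hence is the derivative of a test function.
  obtain ⟨φ, hφ, hdφ⟩ := (hη.sub (hψ.const_smul (∫ t, η t))).exists_deriv_eq hconn <| by
    simp only [Pi.sub_apply, Pi.smul_apply, smul_eq_mul]
    rw [integral_sub hη.integrable (hψ.integrable.const_mul _), integral_const_mul, hψ1, mul_one,
      sub_self]
  have horth : ∫ t in U, η t • u t = (∫ t, η t) • c := by
    have := h φ hφ
    simp only [hdφ, Pi.sub_apply, Pi.smul_apply, sub_smul, smul_assoc] at this
    rwa [integral_sub (hη.integrable_smul hu) ((hψ.integrable_smul hu).fun_smul _), integral_smul,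
      sub_eq_zero] at this
  simp only [Pi.sub_apply, smul_sub]
  rw [integral_sub (hη.integrable_smul hu) (hη.integrable.smul_const c).restrict, horth,
    integral_smul_const, hη.setIntegral_eq_integral, sub_self]

theorem IsTestFunction.integral_deriv_smul_integral_Iic {φ : ℝ → ℝ} (hφ : IsTestFunction U φ)
    {μ : Measure ℝ} [SFinite μ] (hu : Integrable u μ) :
    ∫ t, deriv φ t • ∫ r in Iic t, u r ∂μ = -∫ r, φ r • u r ∂μ := by
  have hm : MeasurableSet {p : ℝ × ℝ | p.2 ≤ p.1} := measurableSet_le measurable_snd measurable_fst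
  let F : ℝ × ℝ → E := {p : ℝ × ℝ | p.2 ≤ p.1}.indicator fun p => deriv φ p.1 • u p.2
  have hF : Integrable F (volume.prod μ) := (hφ.deriv.integrable.smul_prod hu).indicator hm
  calc ∫ t, deriv φ t • ∫ r in Iic t, u r ∂μ
      = ∫ t, ∫ r, F (t, r) ∂μ := by
        refine integral_congr_ae (.of_forall fun t => ?_)
        have : (fun r => F (t, r)) = (Iic t).indicator fun r => deriv φ t • u r := by
          ext r; simp [F, indicator]
        simp only [this, integral_indicator measurableSet_Iic, integral_smul]
    _ = ∫ r, (∫ t, F (t, r)) ∂μ := integral_integral_swap (f := fun t r => F (t, r)) hF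
    _ = ∫ r, -(φ r • u r) ∂μ := by
        refine integral_congr_ae (.of_forall fun r => ?_)
        have : (fun t => F (t, r)) = (Ici r).indicator fun t => deriv φ t • u r := by
          ext t; simp [F, indicator]
        simp only [this, integral_indicator measurableSet_Ici, integral_smul_const,
          integral_Ici_eq_integral_Ioi, ← neg_smul]
        rw [hφ.hasCompactSupport.integral_Ioi_deriv_eq (hφ.contDiff.of_le (by simp))]
    _ = -∫ r, φ r • u r ∂μ := integral_neg _

end FundamentalLemmas

end TestFunctions

section WeakDerivative

theorem continuous_integral_Iic {E : Type*} [NormedAddCommGroup E] [NormedSpace ℝ E]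
    {v : ℝ → E} {μ : Measure ℝ} [NullSingletonClass μ] (hv : Integrable v μ) :
    Continuous fun t => ∫ r in Iic t, v r ∂μ := by
  have h := (intervalIntegral.continuous_primitive (fun _ _ => hv.intervalIntegrable) 0).const_add
    (∫ r in Iic (0 : ℝ), v r ∂μ)
  refine h.congr fun t => ?_
  rw [← intervalIntegral.integral_Iic_sub_Iic hv.integrableOn hv.integrableOn, add_sub_cancel]

variable {X : Type*} [NormedAddCommGroup X] [NormedSpace ℝ X] [CompleteSpace X] {T : ℝ}
  {u v v' : ℝ → X}

theorem isWeakDeriv_integral_Iic (hv : Integrable v (volJ T)) :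
    IsWeakDeriv T (fun t => ∫ r in Iic t, v r ∂volJ T) v := by
  intro φ h1 h2 h3
  have hφ : IsTestFunction (Ioo 0 T) φ := ⟨h1, h2, h3⟩
  rw [← hφ.integral_deriv_smul_integral_Iic hv]
  exact setIntegral_eq_integral_of_forall_compl_eq_zero fun t ht => by
    rw [hφ.deriv.eq_zero_of_notMem ht, zero_smul]

namespace IsWeakDeriv

theorem ae_eq (h : IsWeakDeriv T u v) (h' : IsWeakDeriv T u v') (hv : Integrable v (volJ T))
    (hv' : Integrable v' (volJ T)) : v =ᵐ[volJ T] v' := by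
  refine (sub_ae_eq_zero _ _).1 (ae_eq_zero_of_integral_testFunction_smul_eq_zero isOpen_Ioo
    (IntegrableOn.locallyIntegrableOn (hv.sub hv')) fun φ hφ => ?_)
  simp only [Pi.sub_apply, smul_sub]
  rw [integral_sub (hφ.integrable_smul hv) (hφ.integrable_smul hv'), sub_eq_zero,
    ← neg_inj, ← h φ hφ.1 hφ.2 hφ.3, ← h' φ hφ.1 hφ.2 hφ.3]

theorem exists_ae_eq_const_add_integral_Iic (h : IsWeakDeriv T u v) (hu : Integrable u (volJ T))
    (hv : Integrable v (volJ T)) :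
    ∃ c : X, u =ᵐ[volJ T] fun t => c + ∫ r in Iic t, v r ∂volJ T := by
  set P : ℝ → X := fun t => ∫ r in Iic t, v r ∂volJ T
  have hP : Integrable P (volJ T) :=
    ((continuous_integral_Iic hv).integrableOn_Icc).mono_set Ioo_subset_Icc_self
  obtain ⟨c, hc⟩ := exists_ae_eq_const_of_integral_deriv_smul_eq_zero isOpen_Ioo ordConnected_Ioo
    (hu.sub hP) fun φ hφ => by
      simp only [Pi.sub_apply, smul_sub]
      rw [integral_sub (hφ.deriv.integrable_smul hu) (hφ.deriv.integrable_smul hP), sub_eq_zero,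
        h φ hφ.1 hφ.2 hφ.3, isWeakDeriv_integral_Iic hv φ hφ.1 hφ.2 hφ.3]
  refine ⟨c, ?_⟩
  filter_upwards [hc] with t ht
  exact eq_add_of_sub_eq ht

end IsWeakDeriv

end WeakDerivative

namespace SobolevW1

variable {𝕜 X : Type*} [RCLike 𝕜] [NormedAddCommGroup X] [NormedSpace 𝕜 X] [NormedSpace ℝ X]
  [IsScalarTower ℝ 𝕜 X] [CompleteSpace X] {p : ℝ≥0∞} [hp : Fact (1 ≤ p)] {T : ℝ}
  (u v : SobolevW1 𝕜 X p T)

theorem exists_ae_eq_const_add_integral_Iic :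
    ∃ c : X, u.1.1 =ᵐ[volJ T] fun t => c + ∫ r in Iic t, u.1.2 r ∂volJ T :=
  IsWeakDeriv.exists_ae_eq_const_add_integral_Iic u.2 ((Lp.memLp u.1.1).integrable hp.out)
    ((Lp.memLp u.1.2).integrable hp.out)

/-- The continuous representative of `u ∈ W^{1,p}(J; X)`, extended to `ℝ` by its boundary
values. -/
noncomputable def rep (t : ℝ) : X :=
  (exists_ae_eq_const_add_integral_Iic u).choose + ∫ r in Iic t, u.1.2 r ∂volJ T

theorem ae_eq_rep : u.1.1 =ᵐ[volJ T] rep u :=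
  (exists_ae_eq_const_add_integral_Iic u).choose_spec

theorem continuous_rep : Continuous (rep u) :=
  (continuous_integral_Iic ((Lp.memLp u.1.2).integrable hp.out)).const_add _

theorem rep_sub_rep (a b : ℝ) : rep u b - rep u a = ∫ r in a..b, u.1.2 r ∂volJ T := by
  have hv : Integrable u.1.2 (volJ T) := (Lp.memLp u.1.2).integrable hp.out
  rw [rep, rep, add_sub_add_left_eq_sub,
    intervalIntegral.integral_Iic_sub_Iic hv.integrableOn hv.integrableOn]

theorem rep_eqOn_Icc (hT : 0 < T) {f : ℝ → X} (hf : Continuous f) (h : u.1.1 =ᵐ[volJ T] f) :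
    EqOn (rep u) f (Icc 0 T) := by
  refine Measure.eqOn_Icc_of_ae_eq volume hT.ne ?_ (continuous_rep u).continuousOn hf.continuousOn
  rw [← Measure.restrict_congr_set Ioo_ae_eq_Icc]
  exact (ae_eq_rep u).symm.trans h

theorem rep_add (hT : 0 < T) : EqOn (rep (u + v)) (rep u + rep v) (Icc 0 T) :=
  rep_eqOn_Icc (u + v) hT ((continuous_rep u).add (continuous_rep v))
    ((Lp.coeFn_add u.1.1 v.1.1).trans ((ae_eq_rep u).add (ae_eq_rep v)))

theorem rep_smul (hT : 0 < T) (c : 𝕜) : EqOn (rep (c • u)) (c • rep u) (Icc 0 T) :=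
  rep_eqOn_Icc (c • u) hT ((continuous_rep u).const_smul c)
    ((Lp.coeFn_smul c u.1.1).trans ((ae_eq_rep u).const_smul c))

end SobolevW1

section Hardy

/-- Hölder's inequality for `f = (f * v ^ (-(1 - 1 / s))) * v ^ (1 - 1 / s)`. -/
theorem rpow_lintegral_le_lintegral_rpow_mul_weight {α : Type*} [MeasurableSpace α] {μ : Measure α}
    {s : ℝ} (hs : 1 < s) {f v : α → ℝ≥0∞} (hf : AEMeasurable f μ) (hv : AEMeasurable v μ)
    (hv0 : ∀ᵐ x ∂μ, v x ≠ 0) (hvtop : ∀ᵐ x ∂μ, v x ≠ ⊤) :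
    (∫⁻ x, f x ∂μ) ^ s ≤ (∫⁻ x, f x ^ s * v x ^ (1 - s) ∂μ) * (∫⁻ x, v x ∂μ) ^ (s - 1) := by
  have hs0 : 0 < s := by positivity
  have hs1 : s - 1 ≠ 0 := (sub_pos.2 hs).ne'
  set q := s.conjExponent
  have hpq : s.HolderConjugate q := .conjExponent hs
  have hq : q⁻¹ * s = s - 1 := by simp only [q, Real.conjExponent]; field_simp
  have hsplit : ∫⁻ x, f x ∂μ = ∫⁻ x, (fun x => f x * v x ^ (-q⁻¹)) x * v x ^ q⁻¹ ∂μ := by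
    refine lintegral_congr_ae ?_
    filter_upwards [hv0, hvtop] with x h0 htop
    rw [mul_assoc, ← ENNReal.rpow_add _ _ h0 htop, neg_add_cancel, ENNReal.rpow_zero, mul_one]
  calc (∫⁻ x, f x ∂μ) ^ s
      ≤ ((∫⁻ x, (f x * v x ^ (-q⁻¹)) ^ s ∂μ) ^ (1 / s) *
          (∫⁻ x, (v x ^ q⁻¹) ^ q ∂μ) ^ (1 / q)) ^ s := by
        rw [hsplit]
        gcongr
        exact ENNReal.lintegral_mul_le_Lp_mul_Lq μ hpq (hf.mul (hv.pow_const _)) (hv.pow_const _)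
    _ = (∫⁻ x, f x ^ s * v x ^ (1 - s) ∂μ) * (∫⁻ x, v x ∂μ) ^ (s - 1) := by
        simp only [ENNReal.mul_rpow_of_nonneg _ _ hs0.le, ← ENNReal.rpow_mul, one_div, neg_mul, hq,
          neg_sub, inv_mul_cancel₀ hs0.ne', inv_mul_cancel₀ hpq.symm.ne_zero, ENNReal.rpow_one]

theorem lintegral_Ioc_rpow_sub_one {c : ℝ} (hc : 0 < c) {h : ℝ} (hh : 0 ≤ h) :
    ∫⁻ r in Ioc 0 h, ENNReal.ofReal (r ^ (c - 1)) = ENNReal.ofReal (h ^ c / c) := by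
  have hi : IntervalIntegrable (fun r : ℝ => r ^ (c - 1)) volume 0 h :=
    intervalIntegral.intervalIntegrable_rpow' (by linarith)
  rw [← ofReal_integral_eq_lintegral_ofReal
      ((intervalIntegrable_iff_integrableOn_Ioc_of_le hh).1 hi)
      ((ae_restrict_iff' measurableSet_Ioc).2 (.of_forall fun r hr => Real.rpow_nonneg hr.1.le _)),
    ← intervalIntegral.integral_of_le hh, integral_rpow (Or.inl (by linarith)), sub_add_cancel,
    Real.zero_rpow hc.ne', sub_zero]

theorem lintegral_Ioi_rpow_neg_sub_one {c : ℝ} (hc : 0 < c) {h : ℝ} (hh : 0 < h) :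
    ∫⁻ r in Ioi h, ENNReal.ofReal (r ^ (-c - 1)) = ENNReal.ofReal (h ^ (-c) / c) := by
  rw [← ofReal_integral_eq_lintegral_ofReal
      (integrableOn_Ioi_rpow_of_lt (a := -c - 1) (by linarith) hh)
      ((ae_restrict_iff' measurableSet_Ioi).2
        (.of_forall fun r hr => Real.rpow_nonneg (hh.trans hr).le _)),
    integral_Ioi_rpow_of_lt (by linarith) hh, sub_add_cancel, neg_div_neg_eq]

theorem lintegral_Ioi_lintegral_Ioc_swap {G : ℝ → ℝ → ℝ≥0∞}
    (hG : Measurable (Function.uncurry G)) (a : ℝ) :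
    ∫⁻ h in Ioi a, ∫⁻ r in Ioc a h, G h r = ∫⁻ r in Ioi a, ∫⁻ h in Ioi r, G h r := by
  have hm : MeasurableSet {p : ℝ × ℝ | p.2 ≤ p.1} := measurableSet_le measurable_snd measurable_fst
  let F : ℝ × ℝ → ℝ≥0∞ := {p : ℝ × ℝ | p.2 ≤ p.1}.indicator (Function.uncurry G)
  calc ∫⁻ h in Ioi a, ∫⁻ r in Ioc a h, G h r
      = ∫⁻ h in Ioi a, ∫⁻ r in Ioi a, F (h, r) := by
        refine lintegral_congr fun h => ?_
        have : (fun r => F (h, r)) = (Iic h).indicator (G h) := by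
          ext r; simp [F, indicator]
        rw [this, setLIntegral_indicator measurableSet_Iic, Iic_inter_Ioi]
    _ = ∫⁻ r in Ioi a, ∫⁻ h in Ioi a, F (h, r) :=
        lintegral_lintegral_swap (f := fun h r => F (h, r)) (hG.indicator hm).aemeasurable
    _ = ∫⁻ r in Ioi a, ∫⁻ h in Ioi r, G h r := by
        refine setLIntegral_congr_fun measurableSet_Ioi fun r hr => ?_
        have : (fun h => F (h, r)) = (Ici r).indicator fun h => G h r := by
          ext h; simp [F, indicator]
        simp only [this]
        rw [setLIntegral_indicator measurableSet_Ici, inter_eq_left.2 (Ici_subset_Ioi.2 hr),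
          setLIntegral_congr Ioi_ae_eq_Ici]

variable {s : ℝ} {f : ℝ → ℝ≥0∞}

theorem rpow_inv_mul_lintegral_Ioc_le (hs : 1 < s) (hf : Measurable f) {h : ℝ} (hh : 0 < h) :
    (ENNReal.ofReal h⁻¹ * ∫⁻ r in Ioc 0 h, f r) ^ s ≤
      ENNReal.ofReal ((1 - 1 / s)⁻¹ ^ (s - 1)) * ∫⁻ r in Ioc 0 h,
        f r ^ s * ENNReal.ofReal (r ^ (1 - 1 / s)) * ENNReal.ofReal (h ^ (-(1 - 1 / s) - 1)) := by
  have hs0 : 0 < s := by positivity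
  set b := 1 - 1 / s with hb
  have hb0 : 0 < b := sub_pos.2 ((div_lt_one hs0).2 hs)
  have hweight := rpow_lintegral_le_lintegral_rpow_mul_weight hs (μ := volume.restrict (Ioc 0 h))
    (v := fun r => ENNReal.ofReal (r ^ (b - 1))) hf.aemeasurable (by fun_prop)
    (ae_restrict_of_forall_mem measurableSet_Ioc fun r hr => by
      simpa using Real.rpow_pos_of_pos hr.1 _)
    (.of_forall fun _ => ENNReal.ofReal_ne_top)
  have hpow : ∫⁻ r in Ioc 0 h, f r ^ s * ENNReal.ofReal (r ^ (b - 1)) ^ (1 - s) =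
      ∫⁻ r in Ioc 0 h, f r ^ s * ENNReal.ofReal (r ^ b) := by
    refine setLIntegral_congr_fun measurableSet_Ioc fun r hr => ?_
    have hexp : (b - 1) * (1 - s) = b := by rw [hb]; field_simp; ring
    rw [ENNReal.ofReal_rpow_of_pos (Real.rpow_pos_of_pos hr.1 _), ← Real.rpow_mul hr.1.le, hexp]
  have hconst : h⁻¹ ^ s * (h ^ b / b) ^ (s - 1) = b⁻¹ ^ (s - 1) * h ^ (-b - 1) := by
    have hexp : -s + b * (s - 1) = -b - 1 := by rw [hb]; field_simp; ring
    rw [div_eq_mul_inv, Real.mul_rpow (by positivity) (by positivity), ← Real.rpow_mul hh.le,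
      Real.inv_rpow hh.le, ← Real.rpow_neg hh.le, ← mul_assoc, ← Real.rpow_add hh, hexp, mul_comm]
  rw [hpow, lintegral_Ioc_rpow_sub_one hb0 hh.le] at hweight
  rw [lintegral_mul_const _ (by fun_prop), ENNReal.mul_rpow_of_nonneg _ _ hs0.le]
  refine (mul_le_mul_right hweight _).trans_eq ?_
  rw [mul_left_comm, mul_left_comm (ENNReal.ofReal (b⁻¹ ^ (s - 1))),
    ENNReal.ofReal_rpow_of_nonneg (by positivity) hs0.le,
    ENNReal.ofReal_rpow_of_nonneg (by positivity) (by linarith),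
    ← ENNReal.ofReal_mul (by positivity), ← ENNReal.ofReal_mul (by positivity), hconst]

/-- **Hardy's inequality.** -/
theorem lintegral_hardy (hs : 1 < s) (hf : Measurable f) :
    ∫⁻ h in Ioi 0, (ENNReal.ofReal h⁻¹ * ∫⁻ r in Ioc 0 h, f r) ^ s ≤
      ENNReal.ofReal ((1 - 1 / s)⁻¹ ^ s) * ∫⁻ r in Ioi 0, f r ^ s := by
  have hs0 : 0 < s := by positivity
  have hb0 : 0 < 1 - 1 / s := sub_pos.2 ((div_lt_one hs0).2 hs)
  set b := 1 - 1 / s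
  calc ∫⁻ h in Ioi 0, (ENNReal.ofReal h⁻¹ * ∫⁻ r in Ioc 0 h, f r) ^ s
      ≤ ∫⁻ h in Ioi 0, ENNReal.ofReal (b⁻¹ ^ (s - 1)) * ∫⁻ r in Ioc 0 h,
          f r ^ s * ENNReal.ofReal (r ^ b) * ENNReal.ofReal (h ^ (-b - 1)) :=
        setLIntegral_mono' measurableSet_Ioi fun h hh => rpow_inv_mul_lintegral_Ioc_le hs hf hh
    _ = ENNReal.ofReal (b⁻¹ ^ (s - 1)) * ∫⁻ r in Ioi 0, ∫⁻ h in Ioi r,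
          f r ^ s * ENNReal.ofReal (r ^ b) * ENNReal.ofReal (h ^ (-b - 1)) := by
        rw [lintegral_const_mul' _ _ ENNReal.ofReal_ne_top,
          lintegral_Ioi_lintegral_Ioc_swap (by fun_prop)]
    _ = ENNReal.ofReal (b⁻¹ ^ (s - 1)) * ∫⁻ r in Ioi 0, f r ^ s * ENNReal.ofReal b⁻¹ := by
        congr 1
        refine setLIntegral_congr_fun measurableSet_Ioi fun r (hr : 0 < r) => ?_
        rw [lintegral_const_mul _ (by fun_prop), lintegral_Ioi_rpow_neg_sub_one hb0 hr, mul_assoc,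
          ← ENNReal.ofReal_mul (by positivity), Real.rpow_neg hr.le]
        congr 2
        field_simp
    _ = ENNReal.ofReal (b⁻¹ ^ s) * ∫⁻ r in Ioi 0, f r ^ s := by
        rw [lintegral_mul_const _ (by fun_prop), mul_left_comm, mul_comm,
          ← ENNReal.ofReal_mul (by positivity), ← Real.rpow_add_one (by positivity),
          sub_add_cancel]

theorem lintegral_hardy_Ioc (hs : 1 < s) (hf : Measurable f) (ε : ℝ) :
    ∫⁻ h in Ioc 0 ε, (ENNReal.ofReal h⁻¹ * ∫⁻ r in Ioc 0 h, f r) ^ s ≤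
      ENNReal.ofReal ((1 - 1 / s)⁻¹ ^ s) * ∫⁻ r in Ioc 0 ε, f r ^ s := by
  have hs0 : 0 < s := by positivity
  let F : ℝ → ℝ≥0∞ := (Ioc 0 ε).indicator f
  calc ∫⁻ h in Ioc 0 ε, (ENNReal.ofReal h⁻¹ * ∫⁻ r in Ioc 0 h, f r) ^ s
      = ∫⁻ h in Ioc 0 ε, (ENNReal.ofReal h⁻¹ * ∫⁻ r in Ioc 0 h, F r) ^ s := by
        refine setLIntegral_congr_fun measurableSet_Ioc fun h hh => ?_
        have : ∫⁻ r in Ioc 0 h, f r = ∫⁻ r in Ioc 0 h, F r :=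
          setLIntegral_congr_fun measurableSet_Ioc fun r hr =>
            (indicator_of_mem (Ioc_subset_Ioc_right hh.2 hr) f).symm
        rw [this]
    _ ≤ ∫⁻ h in Ioi 0, (ENNReal.ofReal h⁻¹ * ∫⁻ r in Ioc 0 h, F r) ^ s :=
        lintegral_mono_set Ioc_subset_Ioi_self
    _ ≤ ENNReal.ofReal ((1 - 1 / s)⁻¹ ^ s) * ∫⁻ r in Ioi 0, F r ^ s :=
        lintegral_hardy hs (hf.indicator measurableSet_Ioc)
    _ = ENNReal.ofReal ((1 - 1 / s)⁻¹ ^ s) * ∫⁻ r in Ioc 0 ε, f r ^ s := by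
        have hF : (fun r => F r ^ s) = (Ioc 0 ε).indicator fun r => f r ^ s :=
          (indicator_comp_of_zero (g := (· ^ s)) (ENNReal.zero_rpow_of_pos hs0)).symm
        rw [hF, setLIntegral_indicator measurableSet_Ioc, inter_eq_left.2 Ioc_subset_Ioi_self]

theorem lintegral_comp_add_left_add_comp_sub_left {G : ℝ → ℝ≥0∞} (hG : Measurable G) (t h : ℝ) :
    ∫⁻ r in Ioc 0 h, (G (t + r) + G (t - r)) = ∫⁻ r in Ioc (t - h) (t + h), G r := by
  have hright : ∫⁻ r in Ioc 0 h, G (t + r) = ∫⁻ r in Ioc t (t + h), G r := by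
    rw [← (measurePreserving_add_left volume t).setLIntegral_comp_preimage measurableSet_Ioc hG]
    simp
  have hleft : ∫⁻ r in Ioc 0 h, G (t - r) = ∫⁻ r in Ioc (t - h) t, G r := by
    rw [← setLIntegral_congr (Ico_ae_eq_Ioc (a := t - h)),
      ← (Measure.measurePreserving_sub_left volume t).setLIntegral_comp_preimage measurableSet_Ico
        hG]
    simp
  rcases le_or_gt 0 h with hh | hh
  · rw [lintegral_add_left (by fun_prop), hright, hleft, add_comm,
      ← lintegral_union measurableSet_Ioc (Ioc_disjoint_Ioc_of_le le_rfl),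
      Ioc_union_Ioc_eq_Ioc (by linarith) (by linarith)]
  · rw [Ioc_eq_empty (by linarith), Ioc_eq_empty (by linarith)]
    simp

end Hardy

section KFunctional

variable {𝕜 X Y : Type*} [RCLike 𝕜] [NormedAddCommGroup X] [NormedSpace 𝕜 X]
  [NormedAddCommGroup Y] [NormedSpace 𝕜 Y] (ι : Y →L[𝕜] X)

theorem kFunctional_le_norm {t : ℝ} (ht : 0 ≤ t) (x : X) : kFunctional ι t x ≤ ‖x‖ := by
  simpa using kFunctional_le ι ht x 0

theorem norm_le_mul_kFunctional {t : ℝ} (ht : 0 < t) (x : X) :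
    ‖x‖ ≤ (1 + ‖ι‖ / t) * kFunctional ι t x := by
  rw [kFunctional, Real.mul_iInf_of_nonneg (by positivity)]
  refine le_ciInf fun y => ?_
  calc ‖x‖ ≤ ‖x - ι y‖ + ‖ι‖ * ‖y‖ :=
        (norm_le_norm_sub_add x (ι y)).trans (by gcongr; exact ι.le_opNorm y)
    _ ≤ ‖x - ι y‖ + ‖ι‖ * ‖y‖ + (‖ι‖ / t * ‖x - ι y‖ + t * ‖y‖) :=
        le_add_of_nonneg_right (by positivity)
    _ = (1 + ‖ι‖ / t) * (‖x - ι y‖ + t * ‖y‖) := by field_simp; ring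

theorem kFunctional_neg {t : ℝ} (ht : 0 ≤ t) (x : X) :
    kFunctional ι t (-x) = kFunctional ι t x := by
  simpa using kFunctional_smul ι ht (-1 : 𝕜) x

variable [CompleteSpace X]

open UniformSpace

/-- The extension of `ι` to the completion of `Y`. -/
noncomputable def completionExtension : Completion Y →L[𝕜] X :=
  ι.extend (Completion.toComplL (𝕜 := 𝕜))

theorem completionExtension_coe (y : Y) : completionExtension ι y = ι y :=
  ContinuousLinearMap.extend_eq ι (e := Completion.toComplL (𝕜 := 𝕜))
    Completion.denseRange_coe (Completion.isUniformInducing_coe Y) y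

theorem kFunctional_le_of_completion {t : ℝ} (ht : 0 ≤ t) (x : X) (y : Completion Y) :
    kFunctional ι t x ≤ ‖x - completionExtension ι y‖ + t * ‖y‖ := by
  induction y using Completion.induction_on with
  | hp => exact isClosed_le continuous_const (by fun_prop)
  | ih y =>
    rw [completionExtension_coe, Completion.norm_coe]
    exact kFunctional_le ι ht x y

/-- The mean value of `w` is an admissible competitor, up to completing `Y`. -/
theorem kFunctional_le_add_integral_norm {α : Type*} [MeasurableSpace α] {ν : Measure α}
    [IsFiniteMeasure ν] {w : α → Y} (hw : Integrable w ν) {x : X} {A h : ℝ} (hh : 0 < h)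
    (hν : h ≤ ν.real univ) (hA : ∀ᵐ r ∂ν, ‖x - ι (w r)‖ ≤ A) :
    kFunctional ι h x ≤ A + ∫ r, ‖w r‖ ∂ν := by
  let : NormedSpace ℝ X := NormedSpace.restrictScalars ℝ 𝕜 X
  let : NormedSpace ℝ (Completion Y) := NormedSpace.restrictScalars ℝ 𝕜 (Completion Y)
  have : IsScalarTower ℝ 𝕜 X := .of_algebraMap_smul fun _ _ => rfl
  have : IsScalarTower ℝ 𝕜 (Completion Y) := .of_algebraMap_smul fun _ _ => rfl
  have : NeZero ν := ⟨by rintro rfl; simp at hν; linarith⟩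
  set ι' := completionExtension ι
  have hconv : Convex ℝ (ι' ⁻¹' Metric.closedBall x A) :=
    (convex_closedBall x A).linear_preimage (ι'.restrictScalars ℝ).toLinearMap
  have hwc : Integrable (fun r => (w r : Completion Y)) ν :=
    (Completion.toComplL (𝕜 := 𝕜) (E := Y)).integrable_comp hw
  have hmem : ⨍ r, (w r : Completion Y) ∂ν ∈ ι' ⁻¹' Metric.closedBall x A := by
    refine hconv.average_mem (Metric.isClosed_closedBall.preimage ι'.continuous) ?_ hwc
    filter_upwards [hA] with r hr
    rwa [mem_preimage, completionExtension_coe, mem_closedBall_iff_norm']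
  rw [mem_preimage, mem_closedBall_iff_norm'] at hmem
  refine (kFunctional_le_of_completion ι hh.le x (⨍ r, (w r : Completion Y) ∂ν)).trans
    (add_le_add hmem ?_)
  calc h * ‖⨍ r, (w r : Completion Y) ∂ν‖ ≤ ν.real univ * ‖⨍ r, (w r : Completion Y) ∂ν‖ := by
        gcongr
    _ = ‖∫ r, (w r : Completion Y) ∂ν‖ := by
        rw [average_eq, norm_smul, norm_inv, Real.norm_of_nonneg measureReal_nonneg,
          mul_inv_cancel_left₀ (hh.trans_le hν).ne']
    _ ≤ ∫ r, ‖w r‖ ∂ν := by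
        simpa only [Completion.norm_coe] using
          norm_integral_le_integral_norm fun r => (w r : Completion Y)

end KFunctional

section RealInterpENorm

variable {𝕜 X Y : Type*} [RCLike 𝕜] [NormedAddCommGroup X] [NormedSpace 𝕜 X]
  [NormedAddCommGroup Y] [NormedSpace 𝕜 Y] (ι : Y →L[𝕜] X)

theorem setLIntegral_dtOverT {S : Set ℝ} (hS : MeasurableSet S) (F : ℝ → ℝ≥0∞) :
    ∫⁻ t in S, F t ∂dtOverT = ∫⁻ t in S ∩ Ioi 0, ENNReal.ofReal t⁻¹ * F t := by
  rw [dtOverT, restrict_withDensity hS, Measure.restrict_restrict hS,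
    lintegral_withDensity_eq_lintegral_mul_non_measurable _ (by fun_prop)
      (.of_forall fun _ => ENNReal.ofReal_lt_top)]
  rfl

theorem eLpNorm_rpow_neg_dtOverT_Ioi {θ s ε : ℝ} (hθ : 0 < θ) (hs : 0 < s) (hε : 0 < ε) :
    eLpNorm (fun t : ℝ => t ^ (-θ)) (ENNReal.ofReal s) (dtOverT.restrict (Ioi ε)) =
      ENNReal.ofReal (ε ^ (-(θ * s)) / (θ * s)) ^ (1 / s) := by
  rw [eLpNorm_eq_lintegral_rpow_enorm_toReal (by simpa using hs) ENNReal.ofReal_ne_top,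
    ENNReal.toReal_ofReal hs.le, setLIntegral_dtOverT measurableSet_Ioi,
    inter_eq_left.2 (Ioi_subset_Ioi hε.le), ← lintegral_Ioi_rpow_neg_sub_one (by positivity) hε]
  congr 1
  refine setLIntegral_congr_fun measurableSet_Ioi fun t ht => ?_
  have ht0 : 0 < t := hε.trans ht
  rw [Real.enorm_of_nonneg (by positivity), ENNReal.ofReal_rpow_of_nonneg (by positivity) hs.le,
    ← ENNReal.ofReal_mul (by positivity), ← Real.rpow_mul ht0.le, Real.rpow_sub_one ht0.ne',
    div_eq_inv_mul, neg_mul]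

/-- The contribution of `K(t, x)`, `t ≤ ε`, to the norm of `x` in `(X, Y)_{θ, q}`. -/
noncomputable def realInterpENormBelow (θ : ℝ) (q : ℝ≥0∞) (ε : ℝ) (x : X) : ℝ≥0∞ :=
  eLpNorm (fun t => t ^ (-θ) * kFunctional ι t x) q (dtOverT.restrict (Iic ε))

theorem realInterpENormBelow_sub_le (θ : ℝ) (q : ℝ≥0∞) [hq : Fact (1 ≤ q)] (ε : ℝ) (x x' : X) :
    realInterpENormBelow ι θ q ε (x - x') ≤
      realInterpENormBelow ι θ q ε x + realInterpENormBelow ι θ q ε x' := by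
  refine le_trans (eLpNorm_mono_ae_real ?_)
    (eLpNorm_add_le (aestronglyMeasurable_kFunctional ι θ x).restrict
      (aestronglyMeasurable_kFunctional ι θ x').restrict hq.out)
  filter_upwards [ae_restrict_of_ae ae_dtOverT_pos] with t ht
  rw [Pi.add_apply, ← mul_add, Real.norm_of_nonneg
    (mul_nonneg (by positivity) (kFunctional_nonneg ι ht.le _))]
  gcongr
  simpa only [sub_eq_add_neg, kFunctional_neg ι ht.le] using kFunctional_add_le ι ht.le x (-x')

theorem realInterpENorm_le_below_add (θ : ℝ) (q : ℝ≥0∞) [hq : Fact (1 ≤ q)] {ε : ℝ} (hε : 0 < ε)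
    (x : X) :
    realInterpENorm ι θ q x ≤ realInterpENormBelow ι θ q ε x +
      ‖x‖ₑ * eLpNorm (fun t : ℝ => t ^ (-θ)) q (dtOverT.restrict (Ioi ε)) := by
  set f : ℝ → ℝ := fun t => t ^ (-θ) * kFunctional ι t x
  have hf := aestronglyMeasurable_kFunctional ι θ x
  have habove : eLpNorm f q (dtOverT.restrict (Ioi ε)) ≤
      ‖x‖ₑ * eLpNorm (fun t : ℝ => t ^ (-θ)) q (dtOverT.restrict (Ioi ε)) := by
    rw [← enorm_norm x, ← eLpNorm_const_smul]
    refine eLpNorm_mono_ae ?_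
    filter_upwards [ae_restrict_mem measurableSet_Ioi] with t ht
    have ht0 : 0 < t := hε.trans ht
    rw [Pi.smul_apply, smul_eq_mul, norm_mul, norm_mul, mul_comm, norm_norm,
      Real.norm_of_nonneg (kFunctional_nonneg ι ht0.le x)]
    gcongr
    exact kFunctional_le_norm ι ht0.le x
  calc realInterpENorm ι θ q x
      = eLpNorm ((Iic ε).indicator f + (Iic ε)ᶜ.indicator f) q dtOverT := by
        rw [indicator_self_add_compl]; rfl
    _ ≤ eLpNorm ((Iic ε).indicator f) q dtOverT + eLpNorm ((Iic ε)ᶜ.indicator f) q dtOverT :=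
        eLpNorm_add_le (hf.indicator measurableSet_Iic) (hf.indicator measurableSet_Iic.compl)
          hq.out
    _ ≤ _ := by
        rw [eLpNorm_indicator_eq_eLpNorm_restrict measurableSet_Iic,
          eLpNorm_indicator_eq_eLpNorm_restrict measurableSet_Iic.compl, compl_Iic]
        exact add_le_add_right habove _

theorem realInterpENormBelow_eq_lintegral {s : ℝ} (hs : 0 < s) (θ ε : ℝ) (x : X) :
    realInterpENormBelow ι θ (ENNReal.ofReal s) ε x =
      (∫⁻ t in Ioc 0 ε, ENNReal.ofReal (t⁻¹ * (t ^ (-θ) * kFunctional ι t x) ^ s)) ^ (1 / s) := by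
  rw [realInterpENormBelow, eLpNorm_eq_lintegral_rpow_enorm_toReal (by simpa using hs)
    ENNReal.ofReal_ne_top, ENNReal.toReal_ofReal hs.le, setLIntegral_dtOverT measurableSet_Iic,
    Iic_inter_Ioi]
  congr 1
  refine setLIntegral_congr_fun measurableSet_Ioc fun t ht => ?_
  have ht0 : 0 < t := ht.1
  have hK := kFunctional_nonneg ι ht0.le x
  rw [Real.enorm_of_nonneg (by positivity), ENNReal.ofReal_rpow_of_nonneg (by positivity) hs.le,
    ← ENNReal.ofReal_mul (by positivity)]

theorem realInterpENormBelow_one_sub_one_div {s : ℝ} (hs : 0 < s) (ε : ℝ) (x : X) :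
    realInterpENormBelow ι (1 - 1 / s) (ENNReal.ofReal s) ε x =
      (∫⁻ t in Ioc 0 ε,
        (ENNReal.ofReal t⁻¹ * ENNReal.ofReal (kFunctional ι t x)) ^ s) ^ (1 / s) := by
  rw [realInterpENormBelow_eq_lintegral ι hs]
  congr 1
  refine setLIntegral_congr_fun measurableSet_Ioc fun t ht => ?_
  have ht0 : 0 < t := ht.1
  have hK := kFunctional_nonneg ι ht0.le x
  rw [← ENNReal.ofReal_mul (by positivity), ENNReal.ofReal_rpow_of_nonneg (by positivity) hs.le]
  congr 1
  have hexp : -(1 - 1 / s) * s = 1 - s := by field_simp; ring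
  rw [Real.mul_rpow (by positivity) hK, Real.mul_rpow (by positivity) hK, ← Real.rpow_mul ht0.le,
    hexp, Real.rpow_sub ht0, Real.rpow_one, Real.inv_rpow ht0.le]
  field_simp

theorem realInterpENormBelow_le_of_kFunctional_le_lintegral {s : ℝ} (hs : 1 < s) {ε : ℝ} {x : X}
    {f : ℝ → ℝ≥0∞} (hf : Measurable f)
    (h : ∀ t ∈ Ioc 0 ε, ENNReal.ofReal (kFunctional ι t x) ≤ ∫⁻ r in Ioc 0 t, f r) :
    realInterpENormBelow ι (1 - 1 / s) (ENNReal.ofReal s) ε x ≤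
      ENNReal.ofReal (1 - 1 / s)⁻¹ * (∫⁻ r in Ioc 0 ε, f r ^ s) ^ (1 / s) := by
  have hs0 : 0 < s := by positivity
  have hb : 0 < (1 - 1 / s)⁻¹ := inv_pos.2 (sub_pos.2 ((div_lt_one hs0).2 hs))
  calc realInterpENormBelow ι (1 - 1 / s) (ENNReal.ofReal s) ε x
      = (∫⁻ t in Ioc 0 ε,
          (ENNReal.ofReal t⁻¹ * ENNReal.ofReal (kFunctional ι t x)) ^ s) ^ (1 / s) :=
        realInterpENormBelow_one_sub_one_div ι hs0 ε x
    _ ≤ (∫⁻ t in Ioc 0 ε, (ENNReal.ofReal t⁻¹ * ∫⁻ r in Ioc 0 t, f r) ^ s) ^ (1 / s) := by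
        refine ENNReal.rpow_le_rpow (setLIntegral_mono' measurableSet_Ioc fun t ht => ?_)
          (by positivity)
        gcongr
        exact h t ht
    _ ≤ (ENNReal.ofReal ((1 - 1 / s)⁻¹ ^ s) * ∫⁻ r in Ioc 0 ε, f r ^ s) ^ (1 / s) := by
        gcongr
        exact lintegral_hardy_Ioc hs hf ε
    _ = ENNReal.ofReal (1 - 1 / s)⁻¹ * (∫⁻ r in Ioc 0 ε, f r ^ s) ^ (1 / s) := by
        rw [ENNReal.mul_rpow_of_nonneg _ _ (by positivity),
          ENNReal.ofReal_rpow_of_nonneg (Real.rpow_nonneg hb.le _) (by positivity), one_div s,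
          Real.rpow_rpow_inv (by simpa using hb.le) hs0.ne']

theorem realInterpENormBelow_le_of_kFunctional_le_window {s : ℝ} (hs : 1 < s) {ε t : ℝ} {x : X}
    {g : ℝ → ℝ≥0∞} (hg : Measurable g)
    (h : ∀ r ∈ Ioc 0 ε, ENNReal.ofReal (kFunctional ι r x) ≤ ∫⁻ τ in Ioc (t - r) (t + r), g τ) :
    realInterpENormBelow ι (1 - 1 / s) (ENNReal.ofReal s) ε x ≤
      ENNReal.ofReal (1 - 1 / s)⁻¹ *
        (2 * (∫⁻ τ in Ioc (t - ε) (t + ε), g τ ^ s) ^ (1 / s)) := by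
  have hsym := lintegral_comp_add_left_add_comp_sub_left (hg.pow_const s) t ε
  refine (realInterpENormBelow_le_of_kFunctional_le_lintegral ι hs
    (f := fun r => g (t + r) + g (t - r)) (by fun_prop) fun r hr => ?_).trans ?_
  · rw [lintegral_comp_add_left_add_comp_sub_left hg]
    exact h r hr
  · rw [two_mul]
    gcongr
    refine (ENNReal.lintegral_Lp_add_le (by fun_prop) (by fun_prop) hs.le).trans ?_
    rw [← hsym]
    gcongr
    exacts [le_self_add, le_add_self]

theorem realInterpENormBelow_one_le_of_kFunctional_le_rpow {θ α ε M : ℝ} (hα : θ < α) (hε : 0 ≤ ε)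
    (hM : 0 ≤ M) {x : X} (h : ∀ t ∈ Ioc 0 ε, kFunctional ι t x ≤ M * t ^ α) :
    realInterpENormBelow ι θ 1 ε x ≤ ENNReal.ofReal (M * (ε ^ (α - θ) / (α - θ))) := by
  rw [← ENNReal.ofReal_one, realInterpENormBelow_eq_lintegral ι one_pos, ENNReal.ofReal_mul hM,
    ← lintegral_Ioc_rpow_sub_one (sub_pos.2 hα) hε, ← lintegral_const_mul _ (by fun_prop), div_one,
    ENNReal.rpow_one]
  refine setLIntegral_mono' measurableSet_Ioc fun t ht => ?_
  have ht0 : 0 < t := ht.1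
  rw [← ENNReal.ofReal_mul hM, Real.rpow_one]
  refine ENNReal.ofReal_le_ofReal ?_
  calc t⁻¹ * (t ^ (-θ) * kFunctional ι t x) ≤ t⁻¹ * (t ^ (-θ) * (M * t ^ α)) := by
        gcongr
        exact h t ht
    _ = M * t ^ (α - θ - 1) := by
        rw [Real.rpow_sub_one ht0.ne', Real.rpow_sub ht0, Real.rpow_neg ht0.le]
        field_simp

theorem realInterpENorm_one_le_of_kFunctional_le_rpow {θ α d M N : ℝ} (hθ : θ ∈ Ioo 0 α)
    (hd : 0 < d) (hM : 0 ≤ M) {x : X} (h : ∀ t ∈ Ioc 0 d, kFunctional ι t x ≤ M * t ^ α)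
    (hx : ‖x‖ ≤ N * d ^ α) :
    realInterpENorm ι θ 1 x ≤ ENNReal.ofReal ((M / (α - θ) + N / θ) * d ^ (α - θ)) := by
  obtain ⟨hθ0, hθα⟩ := hθ
  have : 0 < α - θ := sub_pos.2 hθα
  have htail : eLpNorm (fun t : ℝ => t ^ (-θ)) 1 (dtOverT.restrict (Ioi d)) =
      ENNReal.ofReal (d ^ (-θ) / θ) := by
    simpa using eLpNorm_rpow_neg_dtOverT_Ioi hθ0 one_pos hd
  calc realInterpENorm ι θ 1 x
      ≤ realInterpENormBelow ι θ 1 d x + ‖x‖ₑ * ENNReal.ofReal (d ^ (-θ) / θ) := by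
        rw [← htail]
        exact realInterpENorm_le_below_add ι θ 1 hd x
    _ ≤ ENNReal.ofReal (M * (d ^ (α - θ) / (α - θ))) +
          ENNReal.ofReal (N * d ^ α) * ENNReal.ofReal (d ^ (-θ) / θ) := by
        gcongr
        · exact realInterpENormBelow_one_le_of_kFunctional_le_rpow ι hθα hd.le hM h
        · rw [← ofReal_norm]
          exact ENNReal.ofReal_le_ofReal hx
    _ = ENNReal.ofReal ((M / (α - θ) + N / θ) * d ^ (α - θ)) := by
        have hN : 0 ≤ N * d ^ α := (norm_nonneg x).trans hx
        rw [← ENNReal.ofReal_mul hN, ← ENNReal.ofReal_add (by positivity) (by positivity)]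
        congr 1
        rw [Real.rpow_sub hd, Real.rpow_neg hd.le]
        field_simp

theorem tendsto_realInterpENorm_sub_zero {A : Type*} {l : Filter A} {θ s : ℝ} [hs : Fact (1 < s)]
    (hθ : 0 < θ) {u : A → X} {x : X} (hu : Tendsto u l (nhds x))
    (hbelow : ∀ η : ℝ≥0∞, 0 < η → ∃ ε > 0,
      realInterpENormBelow ι θ (ENNReal.ofReal s) ε x ≤ η ∧
        ∀ᶠ a in l, realInterpENormBelow ι θ (ENNReal.ofReal s) ε (u a) ≤ η) :
    Tendsto (fun a => realInterpENorm ι θ (ENNReal.ofReal s) (u a - x)) l (nhds 0) := by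
  refine ENNReal.tendsto_nhds_zero.2 fun η hη => ?_
  have hη3 : 0 < η / 3 := ENNReal.div_pos hη.ne' (by simp)
  obtain ⟨ε, hε, hx, hua⟩ := hbelow (η / 3) hη3
  set D := eLpNorm (fun t : ℝ => t ^ (-θ)) (ENNReal.ofReal s) (dtOverT.restrict (Ioi ε))
  have hD : D ≠ ⊤ := by
    have hs0 : 0 < s := one_pos.trans hs.out
    rw [show D = _ from eLpNorm_rpow_neg_dtOverT_Ioi hθ hs0 hε]
    finiteness
  have habove : Tendsto (fun a => ‖u a - x‖ₑ * D) l (nhds 0) := by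
    simpa using ENNReal.Tendsto.mul_const (tendsto_iff_enorm_sub_tendsto_zero.1 hu) (.inr hD)
  filter_upwards [hua, ENNReal.tendsto_nhds_zero.1 habove _ hη3] with a ha hX
  calc realInterpENorm ι θ (ENNReal.ofReal s) (u a - x)
      ≤ realInterpENormBelow ι θ (ENNReal.ofReal s) ε (u a - x) + ‖u a - x‖ₑ * D :=
        realInterpENorm_le_below_add ι θ _ hε _
    _ ≤ η / 3 + η / 3 + η / 3 := by
        gcongr
        exact (realInterpENormBelow_sub_le ι θ _ ε _ _).trans (add_le_add ha hx)
    _ = η := ENNReal.add_thirds η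

end RealInterpENorm

section Lp

variable {p : ℝ≥0∞} [hp : Fact (1 ≤ p)]

variable (p) in
theorem one_sub_one_div_toReal_nonneg : 0 ≤ 1 - 1 / p.toReal := by
  rcases eq_or_ne p ⊤ with rfl | hp'
  · simp
  · have h1 : 1 ≤ p.toReal := by simpa using ENNReal.toReal_mono hp' hp.out
    exact sub_nonneg.2 (div_le_one_of_le₀ h1 (by positivity))

theorem setIntegral_norm_coeFn_le {α Z : Type*} [MeasurableSpace α] [NormedAddCommGroup Z]
    {μ : Measure α} [IsFiniteMeasure μ] (f : Lp Z p μ) (S : Set α) :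
    ∫ r in S, ‖f r‖ ∂μ ≤ ‖f‖ * μ.real S ^ (1 - 1 / p.toReal) := by
  have hf := (Lp.aestronglyMeasurable f).restrict (s := S)
  have h : ∫⁻ r in S, ‖f r‖ₑ ∂μ ≤ ‖f‖ₑ * μ S ^ (1 - 1 / p.toReal) := by
    calc ∫⁻ r in S, ‖f r‖ₑ ∂μ = eLpNorm f 1 (μ.restrict S) := eLpNorm_one_eq_lintegral_enorm.symm
      _ ≤ eLpNorm f p (μ.restrict S) * μ S ^ (1 - 1 / p.toReal) := by
          simpa using eLpNorm_le_eLpNorm_mul_rpow_measure_univ hp.out hf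
      _ ≤ ‖f‖ₑ * μ S ^ (1 - 1 / p.toReal) := by
          rw [Lp.enorm_def]
          gcongr
          exact Measure.restrict_le_self
  rw [integral_norm_eq_lintegral_enorm hf]
  refine (ENNReal.toReal_mono (ENNReal.mul_ne_top enorm_ne_top (ENNReal.rpow_ne_top_of_nonneg
    (one_sub_one_div_toReal_nonneg p) (measure_ne_top μ S))) h).trans_eq ?_
  rw [ENNReal.toReal_mul, toReal_enorm, ← ENNReal.toReal_rpow, measureReal_def]

end Lp

section IntervalVolume

variable {T : ℝ}

theorem volJ_real_Ioc_le {a b : ℝ} (hab : a ≤ b) : (volJ T).real (Ioc a b) ≤ b - a :=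
  ENNReal.toReal_le_of_le_ofReal (sub_nonneg.2 hab)
    ((Measure.restrict_apply_le _ _).trans_eq Real.volume_Ioc)

theorem le_volJ_real_Ioc {t h : ℝ} (ht : t ∈ Icc 0 T) (hh : h ∈ Ioc 0 T) :
    h ≤ (volJ T).real (Ioc (t - h) (t + h)) := by
  obtain ⟨ht0, htT⟩ := ht
  obtain ⟨hh0, hhT⟩ := hh
  have hlen : h ≤ min (t + h) T - max (t - h) 0 := by
    rw [le_sub_iff_add_le, le_min_iff]
    constructor <;> rw [← le_sub_iff_add_le', max_le_iff] <;> constructor <;> linarith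
  calc h ≤ volume.real (Ioo (max (t - h) 0) (min (t + h) T)) := by
        rwa [Real.volume_real_Ioo_of_le (by linarith)]
    _ ≤ (volJ T).real (Ioc (t - h) (t + h)) := by
        rw [measureReal_restrict_apply measurableSet_Ioc, ← Ioo_inter_Ioo]
        exact measureReal_mono (inter_subset_inter_left _ Ioo_subset_Ioc_self)
          (measure_ne_top_of_subset inter_subset_right (by simp))

end IntervalVolume

namespace SobolevW1

variable {𝕜 X : Type*} [RCLike 𝕜] [NormedAddCommGroup X] [NormedSpace 𝕜 X] [NormedSpace ℝ X]
  [IsScalarTower ℝ 𝕜 X] [CompleteSpace X] {p : ℝ≥0∞} [hp : Fact (1 ≤ p)] {T : ℝ}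
  (u : SobolevW1 𝕜 X p T)

theorem norm_rep_sub_rep_le_setIntegral {a b : ℝ} {S : Set ℝ} (hS : uIoc a b ⊆ S) :
    ‖rep u b - rep u a‖ ≤ ∫ r in S, ‖u.1.2 r‖ ∂volJ T := by
  have hv : Integrable (fun r => ‖u.1.2 r‖) (volJ T) := ((Lp.memLp u.1.2).integrable hp.out).norm
  rw [rep_sub_rep]
  exact intervalIntegral.norm_integral_le_integral_norm_uIoc.trans (setIntegral_mono_set
    hv.integrableOn (.of_forall fun _ => norm_nonneg _) hS.eventuallyLE)

theorem norm_rep_sub_rep_le_rpow (a b : ℝ) :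
    ‖rep u b - rep u a‖ ≤ ‖u‖ * |b - a| ^ (1 - 1 / p.toReal) := by
  have hα := one_sub_one_div_toReal_nonneg p
  have hvol : (volJ T).real (uIoc a b) ≤ |b - a| := by
    rw [← max_sub_min_eq_abs]
    exact volJ_real_Ioc_le inf_le_sup
  calc ‖rep u b - rep u a‖ ≤ ∫ r in uIoc a b, ‖u.1.2 r‖ ∂volJ T :=
        norm_rep_sub_rep_le_setIntegral u subset_rfl
    _ ≤ ‖u.1.2‖ * (volJ T).real (uIoc a b) ^ (1 - 1 / p.toReal) :=
        setIntegral_norm_coeFn_le u.1.2 _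
    _ ≤ ‖u‖ * |b - a| ^ (1 - 1 / p.toReal) := by
        gcongr
        exact norm_snd_le u.1

end SobolevW1

namespace MaxRegSpace

variable {𝕜 X Y : Type*} [RCLike 𝕜] [NormedAddCommGroup X] [NormedSpace 𝕜 X]
  [NormedAddCommGroup Y] [NormedSpace 𝕜 Y] [NormedSpace ℝ X] [IsScalarTower ℝ 𝕜 X]
  {ι : Y →L[𝕜] X} {p : ℝ≥0∞} [hp : Fact (1 ≤ p)] {T : ℝ}

/-- The weak derivative of an element of `W^{1,p}(J; X) ∩ L^p(J; Y)`. -/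
def weakDeriv (U : MaxRegSpace ι p T) : Lp X p (volJ T) := U.1.1.1.2

/-- An element of `W^{1,p}(J; X) ∩ L^p(J; Y)` as a (class of) function(s) with values in `Y`. -/
def toLpY (U : MaxRegSpace ι p T) : Lp Y p (volJ T) := U.1.2

theorem norm_weakDeriv_le (U : MaxRegSpace ι p T) : ‖weakDeriv U‖ ≤ ‖U‖ :=
  (norm_snd_le U.1.1.1).trans (norm_fst_le U.1)

theorem norm_toLpY_le (U : MaxRegSpace ι p T) : ‖toLpY U‖ ≤ ‖U‖ := norm_snd_le U.1

theorem ae_toLpY_eq (U : MaxRegSpace ι p T) : ∀ᵐ r ∂volJ T, ι (toLpY U r) = toLp U r := by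
  have h : ι.compLp (toLpY U) = toLp U := U.2
  rw [← h]
  filter_upwards [ι.coeFn_compLp (toLpY U)] with r hr
  exact hr.symm

theorem toLp_injective [CompleteSpace X] (hι : Function.Injective ι) :
    Function.Injective (toLp : MaxRegSpace ι p T → Lp X p (volJ T)) := by
  intro U V h
  have hderiv : weakDeriv U = weakDeriv V := Lp.ext <|
    IsWeakDeriv.ae_eq U.1.1.2 (show IsWeakDeriv T (toLp U) (weakDeriv V) from h ▸ V.1.1.2)
      ((Lp.memLp _).integrable hp.out) ((Lp.memLp _).integrable hp.out)
  have hY : toLpY U = toLpY V := by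
    refine Lp.ext ?_
    filter_upwards [ae_toLpY_eq U, ae_toLpY_eq V] with r hU hV
    exact hι (by rw [hU, hV, h])
  exact Subtype.ext (Prod.ext (Subtype.ext (Prod.ext h hderiv)) hY)

variable [CompleteSpace X]

/-- The continuous representative of an element of `W^{1,p}(J; X) ∩ L^p(J; Y)`. -/
noncomputable def rep (U : MaxRegSpace ι p T) : ℝ → X := SobolevW1.rep U.1.1

theorem toLp_ae_eq_rep (U : MaxRegSpace ι p T) : toLp U =ᵐ[volJ T] rep U :=
  SobolevW1.ae_eq_rep U.1.1

theorem continuous_rep (U : MaxRegSpace ι p T) : Continuous (rep U) :=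
  SobolevW1.continuous_rep U.1.1

theorem norm_rep_sub_rep_le (U : MaxRegSpace ι p T) (a b : ℝ) :
    ‖rep U b - rep U a‖ ≤ ‖U‖ * |b - a| ^ (1 - 1 / p.toReal) :=
  (SobolevW1.norm_rep_sub_rep_le_rpow U.1.1 a b).trans (by gcongr; exact norm_fst_le U.1)

theorem kFunctional_rep_le_integral (U : MaxRegSpace ι p T) {t h : ℝ} (ht : t ∈ Icc 0 T)
    (hh : h ∈ Ioc 0 T) :
    kFunctional ι h (rep U t) ≤
      ∫ r in Ioc (t - h) (t + h), ‖weakDeriv U r‖ ∂volJ T +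
        ∫ r in Ioc (t - h) (t + h), ‖toLpY U r‖ ∂volJ T := by
  refine kFunctional_le_add_integral_norm ι ((Lp.memLp (toLpY U)).integrable hp.out).restrict
    hh.1 ?_ ?_
  · simpa using le_volJ_real_Ioc ht hh
  · filter_upwards [ae_restrict_of_ae (ae_toLpY_eq U), ae_restrict_of_ae (toLp_ae_eq_rep U),
      ae_restrict_mem measurableSet_Ioc] with r hY hrep hr
    rw [hY, hrep]
    refine SobolevW1.norm_rep_sub_rep_le_setIntegral U.1.1 (Ioc_subset_Ioc ?_ ?_)
    · exact le_inf hr.1.le (by linarith [hh.1])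
    · exact sup_le hr.2 (by linarith [hh.1])

theorem kFunctional_rep_le_rpow (U : MaxRegSpace ι p T) {t h : ℝ} (ht : t ∈ Icc 0 T)
    (hh : h ∈ Ioc 0 T) :
    kFunctional ι h (rep U t) ≤ 4 * ‖U‖ * h ^ (1 - 1 / p.toReal) := by
  have hα := one_sub_one_div_toReal_nonneg p
  have hα1 : 1 - 1 / p.toReal ≤ 1 := sub_le_self 1 (by positivity)
  have hh0 : 0 < h := hh.1
  set W := Ioc (t - h) (t + h)
  have hvol : (volJ T).real W ^ (1 - 1 / p.toReal) ≤ 2 * h ^ (1 - 1 / p.toReal) := by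
    calc (volJ T).real W ^ (1 - 1 / p.toReal) ≤ (2 * h) ^ (1 - 1 / p.toReal) := by
          gcongr
          exact (volJ_real_Ioc_le (by linarith)).trans_eq (by ring)
      _ = 2 ^ (1 - 1 / p.toReal) * h ^ (1 - 1 / p.toReal) := Real.mul_rpow two_pos.le hh0.le
      _ ≤ 2 * h ^ (1 - 1 / p.toReal) := by
          gcongr
          exact Real.rpow_le_self_of_one_le one_le_two hα1
  calc kFunctional ι h (rep U t)
      ≤ ∫ r in W, ‖weakDeriv U r‖ ∂volJ T + ∫ r in W, ‖toLpY U r‖ ∂volJ T :=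
        kFunctional_rep_le_integral U ht hh
    _ ≤ ‖U‖ * (2 * h ^ (1 - 1 / p.toReal)) + ‖U‖ * (2 * h ^ (1 - 1 / p.toReal)) := by
        gcongr
        · exact (setIntegral_norm_coeFn_le _ W).trans (by gcongr; exact norm_weakDeriv_le U)
        · exact (setIntegral_norm_coeFn_le _ W).trans (by gcongr; exact norm_toLpY_le U)
    _ = 4 * ‖U‖ * h ^ (1 - 1 / p.toReal) := by ring

theorem norm_rep_le (hT : 0 < T) (U : MaxRegSpace ι p T) {t : ℝ} (ht : t ∈ Icc 0 T) :
    ‖rep U t‖ ≤ (1 + ‖ι‖ / T) * (4 * ‖U‖) * T ^ (1 - 1 / p.toReal) := by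
  rw [mul_assoc]
  refine (norm_le_mul_kFunctional ι hT _).trans ?_
  gcongr
  exact kFunctional_rep_le_rpow U ht ⟨hT, le_rfl⟩

end MaxRegSpace

namespace MaxRegSpace

variable {𝕜 X Y : Type*} [RCLike 𝕜] [NormedAddCommGroup X] [NormedSpace 𝕜 X]
  [NormedAddCommGroup Y] [NormedSpace 𝕜 Y] [NormedSpace ℝ X] [IsScalarTower ℝ 𝕜 X]
  {ι : Y →L[𝕜] X}

section Density

variable {p : ℝ≥0∞} [hp : Fact (1 ≤ p)] {T : ℝ} (U : MaxRegSpace ι p T)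

/-- The function `‖u'‖_X + ‖u‖_Y` on `J`, extended by zero. -/
noncomputable def density : ℝ → ℝ≥0∞ :=
  (Ioo 0 T).indicator fun r => ‖weakDeriv U r‖ₑ + ‖toLpY U r‖ₑ

theorem measurable_density : Measurable (density U) :=
  ((Lp.stronglyMeasurable (weakDeriv U)).enorm.add
    (Lp.stronglyMeasurable (toLpY U)).enorm).indicator measurableSet_Ioo

theorem eLpNorm_density_le : eLpNorm (density U) p volume ≤ 2 * ‖U‖ₑ := by
  have hv := Lp.aestronglyMeasurable (weakDeriv U)
  have hw := Lp.aestronglyMeasurable (toLpY U)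
  rw [density, eLpNorm_indicator_eq_eLpNorm_restrict measurableSet_Ioo]
  refine (eLpNorm_add_le hv.enorm.aestronglyMeasurable hw.enorm.aestronglyMeasurable hp.out).trans
    ?_
  rw [eLpNorm_enorm, eLpNorm_enorm, ← Lp.enorm_def, ← Lp.enorm_def, two_mul]
  exact add_le_add (enorm_le_iff_norm_le.2 (norm_weakDeriv_le U))
    (enorm_le_iff_norm_le.2 (norm_toLpY_le U))

theorem lintegral_density_rpow_le {s : ℝ} [hs : Fact (1 < s)]
    (U : MaxRegSpace ι (ENNReal.ofReal s) T) :
    (∫⁻ r, density U r ^ s) ^ (1 / s) ≤ 2 * ‖U‖ₑ := by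
  have hs0 : 0 < s := one_pos.trans hs.out
  simpa [eLpNorm_eq_lintegral_rpow_enorm_toReal, hs0, hs0.le] using eLpNorm_density_le U

variable [CompleteSpace X]

theorem ofReal_kFunctional_rep_le_lintegral {t h : ℝ} (ht : t ∈ Icc 0 T) (hh : h ∈ Ioc 0 T) :
    ENNReal.ofReal (kFunctional ι h (rep U t)) ≤ ∫⁻ r in Ioc (t - h) (t + h), density U r := by
  have hv : Integrable (weakDeriv U) (volJ T) := (Lp.memLp _).integrable hp.out
  have hw : Integrable (toLpY U) (volJ T) := (Lp.memLp _).integrable hp.out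
  refine (ENNReal.ofReal_le_ofReal (kFunctional_rep_le_integral U ht hh)).trans_eq ?_
  rw [ENNReal.ofReal_add (by positivity) (by positivity),
    ofReal_integral_norm_eq_lintegral_enorm hv.restrict,
    ofReal_integral_norm_eq_lintegral_enorm hw.restrict,
    ← lintegral_add_left (Lp.stronglyMeasurable (weakDeriv U)).enorm, density,
    setLIntegral_indicator measurableSet_Ioo, Measure.restrict_restrict measurableSet_Ioc,
    inter_comm]

end Density

variable [CompleteSpace X]

section OneNorm

variable {p : ℝ≥0∞} [hp : Fact (1 ≤ p)] {T θ : ℝ}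

theorem exists_realInterpENorm_one_rep_le (hT : 0 < T) (hθ : θ ∈ Ioo 0 (1 - 1 / p.toReal)) :
    ∃ C : ℝ≥0, ∀ (U : MaxRegSpace ι p T), ∀ t ∈ Icc 0 T,
      realInterpENorm ι θ 1 (rep U t) ≤ C * ‖U‖ₑ := by
  set α := 1 - 1 / p.toReal
  have hθ0 : 0 < θ := hθ.1
  have hαθ : 0 < α - θ := sub_pos.2 hθ.2
  refine ⟨((4 / (α - θ) + (1 + ‖ι‖ / T) * 4 / θ) * T ^ (α - θ)).toNNReal,
    fun U t ht => ?_⟩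
  refine (realInterpENorm_one_le_of_kFunctional_le_rpow ι hθ hT (by positivity)
    (fun h hh => kFunctional_rep_le_rpow U ht hh) (norm_rep_le hT U ht)).trans_eq ?_
  rw [← ofReal_norm, ENNReal.ofNNReal_toNNReal,
    ← ENNReal.ofReal_mul (by positivity)]
  congr 1
  ring

theorem exists_realInterpENorm_one_rep_sub_rep_le (hθ : θ ∈ Ioo 0 (1 - 1 / p.toReal)) :
    ∃ K : ℝ≥0, ∀ (U : MaxRegSpace ι p T), ∀ t ∈ Icc 0 T, ∀ t' ∈ Icc 0 T,
      realInterpENorm ι θ 1 (rep U t - rep U t') ≤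
        K * ‖U‖ₑ * ENNReal.ofReal |t - t'| ^ (1 - 1 / p.toReal - θ) := by
  set α := 1 - 1 / p.toReal
  have hθ0 : 0 < θ := hθ.1
  have hαθ : 0 < α - θ := sub_pos.2 hθ.2
  refine ⟨(8 / (α - θ) + 1 / θ).toNNReal, fun U t ht t' ht' => ?_⟩
  rcases eq_or_ne t t' with rfl | hne
  · have h0 := realInterpENorm_smul ι θ 1 (0 : 𝕜) 0
    rw [zero_smul, enorm_zero, zero_mul] at h0
    rw [sub_self, h0]
    exact zero_le
  have hd : 0 < |t - t'| := abs_sub_pos.2 hne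
  have hdT : |t - t'| ≤ T := abs_le.2 ⟨by linarith [ht.1, ht'.2], by linarith [ht.2, ht'.1]⟩
  have hK : ∀ h ∈ Ioc 0 |t - t'|,
      kFunctional ι h (rep U t - rep U t') ≤ 8 * ‖U‖ * h ^ α := by
    intro h hh
    have hhT : h ∈ Ioc 0 T := ⟨hh.1, hh.2.trans hdT⟩
    have hadd := kFunctional_add_le ι hh.1.le (rep U t) (-rep U t')
    rw [kFunctional_neg ι hh.1.le, ← sub_eq_add_neg] at hadd
    linarith [kFunctional_rep_le_rpow U ht hhT, kFunctional_rep_le_rpow U ht' hhT]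
  refine (realInterpENorm_one_le_of_kFunctional_le_rpow ι hθ hd (by positivity) hK
    (norm_rep_sub_rep_le U t' t)).trans_eq ?_
  rw [← ofReal_norm, ENNReal.ofNNReal_toNNReal,
    ENNReal.ofReal_rpow_of_nonneg hd.le hαθ.le, ← ENNReal.ofReal_mul (by positivity),
    ← ENNReal.ofReal_mul (by positivity)]
  congr 1
  ring

end OneNorm

section TraceNorm

variable {T s : ℝ} [hs : Fact (1 < s)]

theorem realInterpENormBelow_rep_le (U : MaxRegSpace ι (ENNReal.ofReal s) T) {t ε : ℝ}
    (ht : t ∈ Icc 0 T) (hε : ε ≤ T) :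
    realInterpENormBelow ι (1 - 1 / s) (ENNReal.ofReal s) ε (rep U t) ≤
      ENNReal.ofReal (1 - 1 / s)⁻¹ *
        (2 * (∫⁻ r in Ioc (t - ε) (t + ε), density U r ^ s) ^ (1 / s)) :=
  realInterpENormBelow_le_of_kFunctional_le_window ι hs.out (measurable_density U) fun _ hr =>
    ofReal_kFunctional_rep_le_lintegral U ht ⟨hr.1, hr.2.trans hε⟩

theorem exists_realInterpENorm_rep_le (hT : 0 < T) :
    ∃ C : ℝ≥0, ∀ (U : MaxRegSpace ι (ENNReal.ofReal s) T), ∀ t ∈ Icc 0 T,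
      realInterpENorm ι (1 - 1 / s) (ENNReal.ofReal s) (rep U t) ≤ C * ‖U‖ₑ := by
  have hs0 : 0 < s := one_pos.trans hs.out
  have hα : 0 < 1 - 1 / s := sub_pos.2 ((div_lt_one hs0).2 hs.out)
  set D := eLpNorm (fun t : ℝ => t ^ (-(1 - 1 / s))) (ENNReal.ofReal s) (dtOverT.restrict (Ioi T))
  have hD : D ≠ ⊤ := by
    rw [show D = _ from eLpNorm_rpow_neg_dtOverT_Ioi hα hs0 hT]
    finiteness
  set B := (1 + ‖ι‖ / T) * 4 * T ^ (1 - 1 / s)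
  have hB : 0 ≤ B := by positivity
  have hX (U : MaxRegSpace ι (ENNReal.ofReal s) T) {t : ℝ} (ht : t ∈ Icc 0 T) :
      ‖rep U t‖ₑ ≤ ENNReal.ofReal B * ‖U‖ₑ := by
    rw [← ofReal_norm, ← ofReal_norm, ← ENNReal.ofReal_mul hB]
    refine ENNReal.ofReal_le_ofReal ((norm_rep_le hT U ht).trans_eq ?_)
    rw [ENNReal.toReal_ofReal hs0.le]
    ring
  refine ⟨(ENNReal.ofReal (1 - 1 / s)⁻¹ * 4 + ENNReal.ofReal B * D).toNNReal, fun U t ht => ?_⟩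
  rw [ENNReal.coe_toNNReal (by finiteness)]
  calc realInterpENorm ι (1 - 1 / s) (ENNReal.ofReal s) (rep U t)
      ≤ realInterpENormBelow ι (1 - 1 / s) (ENNReal.ofReal s) T (rep U t) + ‖rep U t‖ₑ * D :=
        realInterpENorm_le_below_add ι _ _ hT _
    _ ≤ ENNReal.ofReal (1 - 1 / s)⁻¹ * (2 * (2 * ‖U‖ₑ)) + ENNReal.ofReal B * ‖U‖ₑ * D := by
        gcongr
        · refine (realInterpENormBelow_rep_le U ht le_rfl).trans ?_
          gcongr
          refine le_trans ?_ (lintegral_density_rpow_le U)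
          gcongr
          exact Measure.restrict_le_self
        · exact hX U ht
    _ = (ENNReal.ofReal (1 - 1 / s)⁻¹ * 4 + ENNReal.ofReal B * D) * ‖U‖ₑ := by ring

theorem exists_realInterpENormBelow_rep_le (hT : 0 < T) (U : MaxRegSpace ι (ENNReal.ofReal s) T)
    {η : ℝ≥0∞} (hη : 0 < η) :
    ∃ ε > 0, ∀ t ∈ Icc 0 T,
      realInterpENormBelow ι (1 - 1 / s) (ENNReal.ofReal s) ε (rep U t) ≤ η := by
  have hs0 : 0 < s := one_pos.trans hs.out
  set c : ℝ≥0∞ := ENNReal.ofReal (1 - 1 / s)⁻¹ * 2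
  have hfin : ∫⁻ r, density U r ^ s ≠ ⊤ := by
    intro htop
    have hle := lintegral_density_rpow_le U
    rw [htop, ENNReal.top_rpow_of_pos (by positivity), top_le_iff] at hle
    exact (by finiteness : 2 * ‖U‖ₑ ≠ ⊤) hle
  have hlim : Tendsto (fun x : ℝ≥0∞ => c * x ^ (1 / s)) (nhds 0) (nhds 0) := by
    have hcont : Continuous fun x : ℝ≥0∞ => c * x ^ (1 / s) :=
      (ENNReal.continuous_const_mul (by finiteness)).comp ENNReal.continuous_rpow_const
    simpa [hs0] using hcont.tendsto 0
  obtain ⟨ρ, hρ, hρη⟩ := ENNReal.nhds_zero_basis.eventually_iff.1 (hlim.eventually_lt_const hη)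
  obtain ⟨δ, hδ, hδρ⟩ := exists_pos_setLIntegral_lt_of_measure_lt hfin hρ.ne'
  obtain ⟨r, hr, hrδ⟩ := ENNReal.lt_iff_exists_nnreal_btwn.1 hδ
  have hr0 : 0 < (r : ℝ) := by exact_mod_cast hr
  refine ⟨min T (r / 2), lt_min hT (by positivity), fun t ht => ?_⟩
  refine (realInterpENormBelow_rep_le U ht (min_le_left _ _)).trans ?_
  rw [← mul_assoc]
  refine (hρη (mem_Iio.2 (hδρ _ (lt_of_le_of_lt ?_ hrδ)))).le
  rw [Real.volume_Ioc, ← ENNReal.ofReal_coe_nnreal]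
  exact ENNReal.ofReal_le_ofReal (by linarith [min_le_right T (r / 2 : ℝ)])

theorem tendsto_realInterpENorm_rep_sub_rep (hT : 0 < T) (U : MaxRegSpace ι (ENNReal.ofReal s) T)
    (t : Icc (0 : ℝ) T) :
    Tendsto (fun t' : Icc (0 : ℝ) T =>
      realInterpENorm ι (1 - 1 / s) (ENNReal.ofReal s) (rep U t' - rep U t)) (nhds t) (nhds 0) := by
  have hα : 0 < 1 - 1 / s := sub_pos.2 ((div_lt_one (one_pos.trans hs.out)).2 hs.out)
  refine tendsto_realInterpENorm_sub_zero ι hα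
    (((continuous_rep U).comp continuous_subtype_val).tendsto t) fun η hη => ?_
  obtain ⟨ε, hε, hbelow⟩ := exists_realInterpENormBelow_rep_le hT U hη
  exact ⟨ε, hε, hbelow t t.2, .of_forall fun t' => hbelow t' t'.2⟩

end TraceNorm

end MaxRegSpace

namespace RealInterp

variable {𝕜 V X Y : Type*} [RCLike 𝕜] [NormedAddCommGroup X] [NormedSpace 𝕜 X]
  [NormedAddCommGroup Y] [NormedSpace 𝕜 Y] {ι : Y →L[𝕜] X} {θ : ℝ} {q : ℝ≥0∞} [Fact (1 ≤ q)]
  [AddCommMonoid V] [Module 𝕜 V]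

theorem enorm_eq (x : RealInterp ι θ q) : ‖x‖ₑ = realInterpENorm ι θ q (incl ι θ q x) := by
  rw [← ofReal_norm, norm_def, ENNReal.ofReal_toReal (enorm_incl_lt_top ι θ q x).ne]

/-- A linear map into `X` with values of finite interpolation norm, regarded as a map into
`(X, Y)_{θ, q}`. -/
def codRestrict (f : V →ₗ[𝕜] X) (hf : ∀ v, realInterpENorm ι θ q (f v) < ⊤) :
    V →ₗ[𝕜] RealInterp ι θ q :=
  LinearMap.codRestrict (realInterpSubmodule ι θ q) f hf

theorem incl_codRestrict (f : V →ₗ[𝕜] X) (hf : ∀ v, realInterpENorm ι θ q (f v) < ⊤) (v : V) :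
    incl ι θ q (codRestrict f hf v) = f v := rfl

end RealInterp

section OperatorsIntoFunctionSpaces

variable {𝕜 A V Z : Type*} [RCLike 𝕜] [NormedAddCommGroup V] [NormedSpace 𝕜 V]
  [NormedAddCommGroup Z] [NormedSpace 𝕜 Z] {P : Submodule 𝕜 V}

theorem enorm_le_coe_mul_enorm {C : ℝ≥0} {z : Z} {v : V} : ‖z‖ₑ ≤ C * ‖v‖ₑ ↔ ‖z‖ ≤ C * ‖v‖ := by
  rw [enorm_eq_nnnorm, enorm_eq_nnnorm]
  norm_cast

/-- The domain is a submodule, like `MaxRegSpace`: unifying the instances of a general normed space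
with those of `MaxRegSpace` is prohibitively slow. -/
theorem exists_clm_continuousMap [TopologicalSpace A] [CompactSpace A] (f : A → P →ₗ[𝕜] Z)
    (hf : ∀ v, Continuous fun a => f a v) {C : ℝ≥0} (hC : ∀ v a, ‖f a v‖ₑ ≤ C * ‖v‖ₑ) :
    ∃ E : P →L[𝕜] C(A, Z), ∀ v a, E v a = f a v := by
  let F : P →ₗ[𝕜] C(A, Z) :=
    { toFun v := ⟨fun a => f a v, hf v⟩
      map_add' v w := ContinuousMap.ext fun a => map_add (f a) v w
      map_smul' c v := ContinuousMap.ext fun a => map_smul (f a) c v }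
  have hF (v : P) : ‖F v‖ ≤ C * ‖v‖ :=
    (ContinuousMap.norm_le _ (by positivity)).2 fun a => enorm_le_coe_mul_enorm.1 (hC v a)
  exact ⟨F.mkContinuous C hF, fun _ _ => rfl⟩

theorem exists_clm_hoelderSpace [MetricSpace A] {β : ℝ≥0} (hβ : 0 < β) (f : A → P →ₗ[𝕜] Z)
    {C K : ℝ≥0} (hC : ∀ v a, ‖f a v‖ₑ ≤ C * ‖v‖ₑ)
    (hK : ∀ v, HolderWith (K * ‖v‖₊) β fun a => f a v) :
    ∃ E : P →L[𝕜] HoelderSpace 𝕜 A β Z, ∀ v a, HoelderSpace.toBCF 𝕜 A β Z (E v) a = f a v := by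
  have hC' (v : P) (a : A) : ‖f a v‖ ≤ C * ‖v‖ := enorm_le_coe_mul_enorm.1 (hC v a)
  let F₀ : P →ₗ[𝕜] A →ᵇ Z :=
    { toFun v := .ofNormedAddCommGroup (fun a => f a v) ((hK v).continuous hβ) _ (hC' v)
      map_add' v w := BoundedContinuousFunction.ext fun a => map_add (f a) v w
      map_smul' c v := BoundedContinuousFunction.ext fun a => map_smul (f a) c v }
  let F : P →ₗ[𝕜] HoelderSpace 𝕜 A β Z :=
    F₀.codRestrict (hoelderSubmodule 𝕜 A β Z) fun v => (hK v).memHolder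
  have hF (v : P) : ‖F v‖ ≤ (C + K) * ‖v‖ := by
    rw [HoelderSpace.norm_def, add_mul]
    refine add_le_add ?_ ?_
    · exact BoundedContinuousFunction.norm_ofNormedAddCommGroup_le _ (by positivity) (hC' v)
    · exact_mod_cast (hK v).nnholderNorm_le
  exact ⟨F.mkContinuous (C + K) hF, fun _ _ => rfl⟩

end OperatorsIntoFunctionSpaces

namespace MaxRegSpace

variable {𝕜 X Y : Type*} [RCLike 𝕜] [NormedAddCommGroup X] [NormedSpace 𝕜 X]
  [NormedAddCommGroup Y] [NormedSpace 𝕜 Y] [NormedSpace ℝ X] [IsScalarTower ℝ 𝕜 X]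
  [CompleteSpace X] {ι : Y →L[𝕜] X} {T : ℝ}

section Trace

variable {p : ℝ≥0∞} [Fact (1 ≤ p)]

theorem injective_of_ae_eq_toLp (hι : Function.Injective ι) {Z : Type*}
    {E : MaxRegSpace ι p T → Z} {val : Z → Ioo 0 T → X}
    (hE : ∀ U, ∀ᵐ t : ℝ, ∀ ht : t ∈ Ioo 0 T, val (E U) ⟨t, ht⟩ = toLp U t) :
    Function.Injective E := fun U U' h => toLp_injective hι <| Lp.ext <| by
  rw [Filter.EventuallyEq, ae_restrict_iff' measurableSet_Ioo]
  filter_upwards [hE U, hE U'] with t hU hU' ht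
  rw [← hU ht, ← hU' ht, h]

theorem ae_rep_eq_toLp (U : MaxRegSpace ι p T) : ∀ᵐ t : ℝ, t ∈ Ioo 0 T → rep U t = toLp U t :=
  (ae_restrict_iff' measurableSet_Ioo).1 ((toLp_ae_eq_rep U).mono fun _ => Eq.symm)

/-- The value at `t ∈ [0, T]` of the continuous representative, as a linear map. -/
noncomputable def eval (hT : 0 < T) (t : Icc (0 : ℝ) T) : MaxRegSpace ι p T →ₗ[𝕜] X where
  toFun U := rep U t
  map_add' U V := SobolevW1.rep_add U.1.1 V.1.1 hT t.2
  map_smul' c U := SobolevW1.rep_smul U.1.1 hT c t.2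

/-- The evaluation at `t ∈ [0, T]` as a linear map into `(X, Y)_{θ, q}`. -/
noncomputable def trace (hT : 0 < T) (θ : ℝ) (q : ℝ≥0∞) [Fact (1 ≤ q)]
    (h : ∀ U : MaxRegSpace ι p T, ∀ t ∈ Icc 0 T, realInterpENorm ι θ q (rep U t) < ⊤)
    (t : Icc (0 : ℝ) T) : MaxRegSpace ι p T →ₗ[𝕜] RealInterp ι θ q :=
  RealInterp.codRestrict (eval (ι := ι) (p := p) hT t) fun U => h U t t.2

variable {hT : 0 < T} {θ : ℝ} {q : ℝ≥0∞} [Fact (1 ≤ q)]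
  {h : ∀ U : MaxRegSpace ι p T, ∀ t ∈ Icc 0 T, realInterpENorm ι θ q (rep U t) < ⊤}

theorem incl_trace (U : MaxRegSpace ι p T) (t : Icc (0 : ℝ) T) :
    RealInterp.incl ι θ q (trace hT θ q h t U) = rep U t :=
  RealInterp.incl_codRestrict _ _ U

theorem enorm_trace (U : MaxRegSpace ι p T) (t : Icc (0 : ℝ) T) :
    ‖trace hT θ q h t U‖ₑ = realInterpENorm ι θ q (rep U t) := by
  rw [RealInterp.enorm_eq, incl_trace]

theorem enorm_trace_sub_trace (U : MaxRegSpace ι p T) (t t' : Icc (0 : ℝ) T) :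
    ‖trace hT θ q h t U - trace hT θ q h t' U‖ₑ = realInterpENorm ι θ q (rep U t - rep U t') := by
  rw [RealInterp.enorm_eq, map_sub, incl_trace, incl_trace]

end Trace

theorem exists_embedding_continuousMap {s : ℝ} [Fact (1 < s)] (hι : Function.Injective ι)
    (hT : 0 < T) :
    ∃ E : MaxRegSpace ι (ENNReal.ofReal s) T →L[𝕜]
        C(Icc (0 : ℝ) T, RealInterp ι (1 - 1 / s) (ENNReal.ofReal s)),
      Function.Injective E ∧
      ∀ U : MaxRegSpace ι (ENNReal.ofReal s) T, ∀ᵐ t : ℝ, ∀ ht : t ∈ Ioo 0 T,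
        RealInterp.incl ι (1 - 1 / s) (ENNReal.ofReal s) (E U ⟨t, Ioo_subset_Icc_self ht⟩) =
          toLp U t := by
  obtain ⟨C, hC⟩ := exists_realInterpENorm_rep_le (ι := ι) (s := s) hT
  have hfin (U : MaxRegSpace ι (ENNReal.ofReal s) T) (t : ℝ) (ht : t ∈ Icc 0 T) :
      realInterpENorm ι (1 - 1 / s) (ENNReal.ofReal s) (rep U t) < ⊤ :=
    (hC U t ht).trans_lt (by finiteness)
  let f (t : Icc 0 T) : MaxRegSpace ι (ENNReal.ofReal s) T →ₗ[𝕜] RealInterp ι _ _ :=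
    trace hT (1 - 1 / s) (ENNReal.ofReal s) hfin t
  have hf (U : MaxRegSpace ι (ENNReal.ofReal s) T) : Continuous fun t => f t U :=
    continuous_iff_continuousAt.2 fun t => tendsto_iff_enorm_sub_tendsto_zero.2 <| by
      simpa only [f, enorm_trace_sub_trace] using tendsto_realInterpENorm_rep_sub_rep hT U t
  have hfC (U : MaxRegSpace ι (ENNReal.ofReal s) T) (t : Icc 0 T) : ‖f t U‖ₑ ≤ C * ‖U‖ₑ := by
    rw [enorm_trace]
    exact hC U t t.2
  obtain ⟨E, hE⟩ := exists_clm_continuousMap f hf hfC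
  have hae (U : MaxRegSpace ι (ENNReal.ofReal s) T) : ∀ᵐ t : ℝ, ∀ ht : t ∈ Ioo 0 T,
      RealInterp.incl ι _ _ (E U ⟨t, Ioo_subset_Icc_self ht⟩) = toLp U t := by
    filter_upwards [ae_rep_eq_toLp U] with t h ht
    rw [hE, incl_trace, h ht]
  exact ⟨E, injective_of_ae_eq_toLp (val := fun f t => RealInterp.incl ι _ _
    (f ⟨t, Ioo_subset_Icc_self t.2⟩)) hι hae, hae⟩

theorem exists_embedding_hoelderSpace {p : ℝ≥0∞} [Fact (1 ≤ p)] (hι : Function.Injective ι)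
    (hT : 0 < T) {θ : ℝ} {β : ℝ≥0} (hθ : θ ∈ Ioo 0 (1 - 1 / p.toReal))
    (hβ : (β : ℝ) = 1 - 1 / p.toReal - θ) :
    ∃ E : MaxRegSpace ι p T →L[𝕜] HoelderSpace 𝕜 (Ioo (0 : ℝ) T) β (RealInterp ι θ 1),
      Function.Injective E ∧
      ∀ U : MaxRegSpace ι p T, ∀ᵐ t : ℝ, ∀ ht : t ∈ Ioo 0 T,
        RealInterp.incl ι θ 1
            (HoelderSpace.toBCF 𝕜 (Ioo (0 : ℝ) T) β (RealInterp ι θ 1) (E U) ⟨t, ht⟩) =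
          toLp U t := by
  obtain ⟨C, hC⟩ := exists_realInterpENorm_one_rep_le (ι := ι) hT hθ
  obtain ⟨K, hK⟩ := exists_realInterpENorm_one_rep_sub_rep_le (ι := ι) (T := T) hθ
  have hβ0 : 0 < β := by exact_mod_cast hβ ▸ sub_pos.2 hθ.2
  have hfin (U : MaxRegSpace ι p T) (t : ℝ) (ht : t ∈ Icc 0 T) :
      realInterpENorm ι θ 1 (rep U t) < ⊤ :=
    (hC U t ht).trans_lt (by finiteness)
  let f (t : Ioo 0 T) : MaxRegSpace ι p T →ₗ[𝕜] RealInterp ι θ 1 :=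
    trace hT θ 1 hfin ⟨t, Ioo_subset_Icc_self t.2⟩
  have hf (U : MaxRegSpace ι p T) : HolderWith (K * ‖U‖₊) β fun t => f t U := fun t t' => by
    rw [edist_eq_enorm_sub, enorm_trace_sub_trace, edist_dist, Subtype.dist_eq, Real.dist_eq, hβ]
    exact hK U t (Ioo_subset_Icc_self t.2) t' (Ioo_subset_Icc_self t'.2)
  have hfC (U : MaxRegSpace ι p T) (t : Ioo 0 T) : ‖f t U‖ₑ ≤ C * ‖U‖ₑ := by
    rw [enorm_trace]
    exact hC U t (Ioo_subset_Icc_self t.2)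
  obtain ⟨E, hE⟩ := exists_clm_hoelderSpace hβ0 f hfC hf
  have hae (U : MaxRegSpace ι p T) : ∀ᵐ t : ℝ, ∀ ht : t ∈ Ioo 0 T, RealInterp.incl ι θ 1
      (HoelderSpace.toBCF 𝕜 (Ioo (0 : ℝ) T) β (RealInterp ι θ 1) (E U) ⟨t, ht⟩) = toLp U t := by
    filter_upwards [ae_rep_eq_toLp U] with t h ht
    rw [hE, incl_trace, h ht]
  exact ⟨E, injective_of_ae_eq_toLp (val := fun f t => RealInterp.incl ι θ 1
    (HoelderSpace.toBCF 𝕜 (Ioo (0 : ℝ) T) β (RealInterp ι θ 1) f t)) hι hae, hae⟩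

end MaxRegSpace

theorem lemma3p4_general {𝕜 X Y : Type*} [RCLike 𝕜]
    [NormedAddCommGroup X] [NormedSpace 𝕜 X] [NormedSpace ℝ X] [IsScalarTower ℝ 𝕜 X]
    [CompleteSpace X] [NormedAddCommGroup Y] [NormedSpace 𝕜 Y]
    (ι : Y →L[𝕜] X) (hι : Function.Injective ι) (T : ℝ) (hT : 0 < T)
    (s : ℝ) [hs : Fact (1 < s)] :
    (∃ E : MaxRegSpace ι (ENNReal.ofReal s) T →L[𝕜]
        C(Icc (0 : ℝ) T, RealInterp ι (1 - 1 / s) (ENNReal.ofReal s)),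
      Function.Injective E ∧
      ∀ u : MaxRegSpace ι (ENNReal.ofReal s) T, ∀ᵐ t : ℝ, ∀ ht : t ∈ Ioo 0 T,
        RealInterp.incl ι (1 - 1 / s) (ENNReal.ofReal s) (E u ⟨t, Ioo_subset_Icc_self ht⟩) =
          MaxRegSpace.toLp u t) ∧
    (∀ (θ : ℝ) (β : ℝ≥0), θ ∈ Ioo 0 (1 - 1 / s) → (β : ℝ) = 1 - 1 / s - θ →
      ∃ E : MaxRegSpace ι (ENNReal.ofReal s) T →L[𝕜]
          HoelderSpace 𝕜 (Ioo (0 : ℝ) T) β (RealInterp ι θ 1),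
        Function.Injective E ∧
        ∀ u : MaxRegSpace ι (ENNReal.ofReal s) T, ∀ᵐ t : ℝ, ∀ ht : t ∈ Ioo 0 T,
          RealInterp.incl ι θ 1
              (HoelderSpace.toBCF 𝕜 (Ioo (0 : ℝ) T) β (RealInterp ι θ 1) (E u) ⟨t, ht⟩) =
            MaxRegSpace.toLp u t) := by
  have hs' : (ENNReal.ofReal s).toReal = s := ENNReal.toReal_ofReal (zero_le_one.trans hs.out.le)
  refine ⟨MaxRegSpace.exists_embedding_continuousMap hι hT, fun θ β hθ hβ => ?_⟩
  exact MaxRegSpace.exists_embedding_hoelderSpace hι hT (hs'.symm ▸ hθ) (hs'.symm ▸ hβ)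

theorem lemma3p4 {𝕜 X Y : Type*} [RCLike 𝕜]
    [NormedAddCommGroup X] [NormedSpace 𝕜 X] [NormedSpace ℝ X] [IsScalarTower ℝ 𝕜 X]
    [CompleteSpace X] [NormedAddCommGroup Y] [NormedSpace 𝕜 Y] [CompleteSpace Y]
    (ι : Y →L[𝕜] X) (hι : Function.Injective ι) (T : ℝ) (hT : 0 < T)
    (s : ℝ) [hs : Fact (1 < s)] :
    (∃ E : MaxRegSpace ι (ENNReal.ofReal s) T →L[𝕜]
        C(Icc (0 : ℝ) T, RealInterp ι (1 - 1 / s) (ENNReal.ofReal s)),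
      Function.Injective E ∧
      ∀ u : MaxRegSpace ι (ENNReal.ofReal s) T, ∀ᵐ t : ℝ, ∀ ht : t ∈ Ioo 0 T,
        RealInterp.incl ι (1 - 1 / s) (ENNReal.ofReal s) (E u ⟨t, Ioo_subset_Icc_self ht⟩) =
          MaxRegSpace.toLp u t) ∧
    (∀ (θ : ℝ) (β : ℝ≥0), θ ∈ Ioo 0 (1 - 1 / s) → (β : ℝ) = 1 - 1 / s - θ →
      ∃ E : MaxRegSpace ι (ENNReal.ofReal s) T →L[𝕜]
          HoelderSpace 𝕜 (Ioo (0 : ℝ) T) β (RealInterp ι θ 1),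
        Function.Injective E ∧
        ∀ u : MaxRegSpace ι (ENNReal.ofReal s) T, ∀ᵐ t : ℝ, ∀ ht : t ∈ Ioo 0 T,
          RealInterp.incl ι θ 1
              (HoelderSpace.toBCF 𝕜 (Ioo (0 : ℝ) T) β (RealInterp ι θ 1) (E u) ⟨t, ht⟩) =
            MaxRegSpace.toLp u t) :=
  lemma3p4_general ι hι T hT s
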